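/- **Setting.** A system consists of shards, linearly ordered (the ring order). Every shard $S$ has $n$ replicas $(S,i)$, of which at most $f$ are byzantine, where $n\ge 3f+1$; put $\mathbf{nf}=n-f$. Every data-item is owned by exactly one shard. A transaction $T$ has known finite read and write sets; $\mathfrak I(T)$ is the set of shards that own an item accessed by $T$, and $T$ is cross-shard if $|\mathfrak I(T)|>1$. Two transactions conflict at a shard $S$ if they access a common data-item owned by $S$. The network is asynchronous: messages may be lost, delayed, duplicated and reordered. Messages and client requests are authenticated, and hashes are treated as collision-free. Byzantine replicas may send arbitrary messages in their own name; clients may issue any transactions. **Protocol (RingBFT over PBFT).** Each shard runs PBFT (pre-prepare, prepare, commit with quorums of $\mathbf{nf}$ replicas, and PBFT's view change in which the new primary and the backups choose, for each sequence number, a request from the prepared/pre-prepared sets reported by $\mathbf{nf}$ replicas, or a null request). A non-faulty replica of $S\in\mathfrak I(T)$ supports a fresh proposal of $T$ only if $T$ was signed by a client and either $S$ is the first shard of $\mathfrak I(T)$, or the replica holds Forward messages for $T$ from $f+1$ distinct replicas of the preceding shard of $\mathfrak I(T)$, each with $\mathbf{nf}$ signatures on identical commit messages for $T$. A non-faulty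 replica handles the committed requests in the order of their sequence numbers $k=1,2,\dots$: at $k$ it locks the local items of the transaction (waiting until they are unlocked) and, if the transaction is cross-shard, sends Forward to the next shard of $\mathfrak I(T)$ in cyclic ring order; null requests and transactions handled before are skipped. While it holds the locks for $T$ it may execute its fragment if its shard is the last one of $\mathfrak I(T)$ (for a single-shard transaction, the only one), or if its shard is the first one and it has such Forward messages from $f+1$ replicas of the last shard, or if it has Execute messages for $T$ from $f+1$ replicas of the (cyclically) preceding shard. On execution it appends $T$ to its log as the $k$-th transaction, releases the locks, and, if $T$ is cross-shard, sends Execute to the next shard. **Theorem (Safety).** In every state reachable in a run of this protocol the following hold for all non-faulty replicas. 1. *Involvement.* If a non-faulty replica of any shard has executed $T$, then every shard $S\in\mathfrak I(T)$ has processed $T$, that is, some non-faulty replica of $S$ has ordered $T$ and acquired its locks. Only replicas of shards in $\mathfrak I(T)$ do so. 2. *Non-divergence.* If two non-faulty replicas of one shard have executed $T$ and $T'$, respectively, as the $k$-th transaction of that shard, then $T=T'$. 3. *Consistence.* There is a single strict total order $\prec$ of all transactions such that, whenever a non-faulty replica of a shard $S$ has executed $T$ before $T'$ and $T,T'$ conflict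 at $S$, one has $T\prec T'$. Specifically: 4. All non-faulty replicas of a shard execute each transaction in the same order: if two of them have executed $T$ as the $k$-th and as the $k'$-th transaction, respectively, then $k=k'$; each executes $T$ at most once; and a replica executes two transactions that conflict at its shard in the order of their sequence numbers. 5. Conflicting transactions are executed in the same order by all non-faulty replicas of all involved shards at which they conflict: if $T,T'$ conflict at $S$ and at $U$ (possibly $S=U$), some non-faulty replica of $S$ has executed $T$ before $T'$, and a non-faulty replica of $U$ has executed $T'$, then the latter has executed $T$ before $T'$. -/

import Mathlib

namespace RingBFT

/-- A sharded-replicated system.  Every shard has replicas `(s, i)` with `i : Fin n`; at most `f` of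
them are meant to be byzantine.  Every data-item has one owner shard (the data is partitioned), and the
read and write sets of a transaction are known in advance (deterministic transactions).  The ring
order of the shards is the linear order on `Shard`. -/
structure System (Shard Item Tx : Type*) where
  n : ℕ
  f : ℕ
  byz : Set (Shard × Fin n)
  owner : Item → Shard
  reads : Tx → Finset Item
  writes : Tx → Finset Item

/-- A request on which a shard runs consensus at some sequence number: a client transaction, or the
null request `none` with which a view change fills a gap. -/
abbrev Req (Tx : Type*) := Option Tx

/-- `(v, k, d)`: request `d` at sequence number `k` in view `v`. -/
abbrev Entry (Tx : Type*) := ℕ × ℕ × Req Tx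

/-- Protocol messages.  Digests are identified with the requests that they stand for (ideal
collision-resistant hash).
* `prePrepare`, `prepare`, `commit`: the three phases of the local consensus in view `v` at
  sequence number `k`;
* `viewChange v P Q`: request to move to view `v`; `P` lists what the sender prepared and `Q` what it
  pre-prepared in earlier views;
* `newView v D P Q top X`: installs view `v` on the basis of the view-change messages
  `viewChange v (P i) (Q i)` of the replicas `i ∈ D`, with request `X k` at every `1 ≤ k ≤ top`;
* `forward T v k A`: transaction `T` was ordered in the shard of the sender, as is shown by the
  signatures of the replicas in `A` on `commit v k T`;
* `execute T`: the sender has executed its fragment of `T`. -/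
inductive Msg (Tx : Type*) (n : ℕ) where
  | prePrepare (v k : ℕ) (T : Tx)
  | prepare (v k : ℕ) (d : Req Tx)
  | commit (v k : ℕ) (d : Req Tx)
  | viewChange (v : ℕ) (P Q : Set (Entry Tx))
  | newView (v : ℕ) (D : Finset (Fin n)) (P Q : Fin n → Set (Entry Tx)) (top : ℕ) (X : ℕ → Req Tx)
  | forward (T : Tx) (v k : ℕ) (A : Finset (Fin n))
  | execute (T : Tx)

/-- Local state of a replica.
* `view`, `active`: current view, and whether it is installed (not waiting for a new view);
* `top`: last sequence number that was filled by the new-view message of the current view;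
* `kmax`: last sequence number that was handled (locked or skipped);
* `locks`: transactions, with their sequence numbers, that hold the locks on their local data-items;
* `log`: executed transactions with their sequence numbers, in the temporal order of execution. -/
structure Loc (Tx : Type*) where
  view : ℕ
  active : Bool
  top : ℕ
  kmax : ℕ
  locks : Set (ℕ × Tx)
  log : List (ℕ × Tx)

/-- Global state.
* `requests`: transactions that some client has signed and issued;
* `sent`: authenticated messages that were issued, each with its author;
* `inbox r`: messages that replica `r` has received. -/
structure State (Shard Tx : Type*) (n : ℕ) where
  requests : Set Tx
  sent : Set ((Shard × Fin n) × Msg Tx n)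
  inbox : Shard × Fin n → Set ((Shard × Fin n) × Msg Tx n)
  loc : Shard × Fin n → Loc Tx

section Protocol

variable {Shard Item Tx : Type*} [LinearOrder Shard] (R : System Shard Item Tx)

/-- `nf = n - f`, the size of a quorum. -/
def System.nf : ℕ := R.n - R.f

/-- Transaction `T` accesses data-item `x`. -/
def System.Accesses (T : Tx) (x : Item) : Prop := x ∈ R.reads T ∨ x ∈ R.writes T

/-- The set of involved shards of a transaction. -/
def System.involved (T : Tx) : Finset Shard :=
  (R.reads T).image R.owner ∪ (R.writes T).image R.owner

/-- Cross-shard transactions. -/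
def System.IsCross (T : Tx) : Prop := 1 < (R.involved T).card

/-- The two transactions conflict at shard `s`: both access a common data-item of `s`. -/
def System.ConflictAt (s : Shard) (T T' : Tx) : Prop :=
  ∃ x, R.owner x = s ∧ R.Accesses T x ∧ R.Accesses T' x

/-- `s` is the first involved shard of `T` in ring order (the initiator shard). -/
def System.IsFirst (T : Tx) (s : Shard) : Prop :=
  s ∈ R.involved T ∧ ∀ u ∈ R.involved T, s ≤ u

/-- `s` is the last involved shard of `T` in ring order. -/
def System.IsLast (T : Tx) (s : Shard) : Prop :=
  s ∈ R.involved T ∧ ∀ u ∈ R.involved T, u ≤ s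

/-- `u` is the predecessor of `s` on the ring of the involved shards of `T`; the predecessor of the
first shard is the last one. -/
def System.IsPrev (T : Tx) (u s : Shard) : Prop :=
  (u ∈ R.involved T ∧ s ∈ R.involved T ∧ u < s ∧ ∀ w ∈ R.involved T, ¬ (u < w ∧ w < s)) ∨
    (R.IsLast T u ∧ R.IsFirst T s)

/-- The primary of view `v` of a shard. -/
def System.IsPrimary (r : Shard × Fin R.n) (v : ℕ) : Prop := r.2.val = v % R.n

/-- Initial state: nothing was sent, all replicas are in view `0`, sequence numbers start at `1`. -/
def System.start : State Shard Tx R.n where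
  requests := ∅
  sent := ∅
  inbox := fun _ => ∅
  loc := fun _ => ⟨0, true, 0, 0, ∅, []⟩

variable {R}

/-- Replica `r` changes its local state to `l` and sends the messages in `ms`. -/
def act (σ : State Shard Tx R.n) (r : Shard × Fin R.n) (l : Loc Tx) (ms : Set (Msg Tx R.n)) :
    State Shard Tx R.n :=
  { σ with
    sent := σ.sent ∪ {p | p.1 = r ∧ p.2 ∈ ms}
    loc := Function.update σ.loc r l }

/-- Replica `r` has received messages with property `p` from `c` distinct replicas of shard `s`. -/
def HasFrom (σ : State Shard Tx R.n) (r : Shard × Fin R.n) (s : Shard) (c : ℕ)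
    (p : Msg Tx R.n → Prop) : Prop :=
  ∃ A : Finset (Fin R.n), c ≤ A.card ∧ ∀ i ∈ A, ∃ m, p m ∧ ((s, i), m) ∈ σ.inbox r

/-- `m` is a forward message for `T` from shard `u`, with valid digital signatures of `nf` distinct
replicas of `u` on identical commit messages.  (A signature verifies iff its owner issued it.) -/
def ValidForward (σ : State Shard Tx R.n) (u : Shard) (T : Tx) (m : Msg Tx R.n) : Prop :=
  ∃ v k A, m = .forward T v k A ∧ R.nf ≤ A.card ∧
    ∀ i ∈ A, ((u, i), Msg.commit v k (some T)) ∈ σ.sent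

/-- Replica `r` may support consensus on `T` in its shard: `T` is signed by a client, and the
shard is the first involved one or `r` holds forward messages from `f + 1` distinct replicas of the
preceding involved shard. -/
def Eligible (σ : State Shard Tx R.n) (r : Shard × Fin R.n) (T : Tx) : Prop :=
  T ∈ σ.requests ∧
    (R.IsFirst T r.1 ∨
      (r.1 ∈ R.involved T ∧ ∃ u, R.IsPrev T u r.1 ∧ HasFrom σ r u (R.f + 1) (ValidForward σ u T)))

/-- Replica `r`, which holds the locks for `T`, may execute its fragment of `T`:
* its shard is the last involved one, so that all involved shards have ordered `T` (for a
  single-shard transaction this is the only case);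
* or its shard is the first involved one and the forward messages of the last involved shard
  have completed the first rotation;
* or it received `execute` messages from `f + 1` distinct replicas of the preceding shard (second
  rotation). -/
def CanExecute (σ : State Shard Tx R.n) (r : Shard × Fin R.n) (T : Tx) : Prop :=
  R.IsLast T r.1 ∨
    (R.IsFirst T r.1 ∧ ∃ u, R.IsLast T u ∧ HasFrom σ r u (R.f + 1) (ValidForward σ u T)) ∨
    (∃ u, R.IsPrev T u r.1 ∧ HasFrom σ r u (R.f + 1) (fun m => m = .execute T))

variable (R) in
/-- View-change decision: request `d` is chosen for `k`, because some replica claims to have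
prepared it in a view `w`, a quorum prepared nothing that contradicts this, and `f + 1` replicas
pre-prepared it in view `w` or later. -/
def System.Chosen (D : Finset (Fin R.n)) (P Q : Fin R.n → Set (Entry Tx)) (k : ℕ) (d : Req Tx) :
    Prop :=
  ∃ w, (∃ i ∈ D, (w, k, d) ∈ P i) ∧
    (∃ A ⊆ D, R.nf ≤ A.card ∧
      ∀ i ∈ A, ∀ w' d', (w', k, d') ∈ P i → w' < w ∨ (w' = w ∧ d' = d)) ∧
    (∃ B ⊆ D, R.f + 1 ≤ B.card ∧ ∀ i ∈ B, ∃ w', w ≤ w' ∧ (w', k, d) ∈ Q i)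

variable (R) in
/-- View-change decision: a quorum prepared nothing for `k`. -/
def System.NonePrepared (D : Finset (Fin R.n)) (P : Fin R.n → Set (Entry Tx)) (k : ℕ) : Prop :=
  ∃ A ⊆ D, R.nf ≤ A.card ∧ ∀ i ∈ A, ∀ w d, (w, k, d) ∉ P i

/-- The new-view message with these contents is correct for view `v` in the eyes of `r`. -/
def ValidNewView (σ : State Shard Tx R.n) (r : Shard × Fin R.n) (v : ℕ) (D : Finset (Fin R.n))
    (P Q : Fin R.n → Set (Entry Tx)) (top : ℕ) (X : ℕ → Req Tx) : Prop :=
  R.nf ≤ D.card ∧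
    (∀ i ∈ D, ((r.1, i), Msg.viewChange v (P i) (Q i)) ∈ σ.inbox r) ∧
    (∀ i ∈ D, ∀ e ∈ P i ∪ Q i, e.1 < v) ∧
    (∀ k, 1 ≤ k → k ≤ top →
      R.Chosen D P Q k (X k) ∨ (X k = none ∧ R.NonePrepared D P k)) ∧
    (∀ k, top < k → R.NonePrepared D P k)

/-- One step of the system.  The order and the choice of steps are arbitrary.  In particular the
network is asynchronous (a message may be delivered at any later time, repeatedly, in any order, or
never), timers may expire at any time, and messages may be retransmitted or relayed. -/
inductive Step : State Shard Tx R.n → State Shard Tx R.n → Prop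
  /-- A client (honest or not) signs and issues a transaction. -/
  | clientRequest (σ) (T : Tx) : Step σ { σ with requests := insert T σ.requests }
  /-- A byzantine replica issues any message in its own name. -/
  | byzantine (σ) (r) (m : Msg Tx R.n) : r ∈ R.byz →
      Step σ { σ with sent := insert (r, m) σ.sent }
  /-- The network delivers a message. -/
  | deliver (σ) (r) (p) : p ∈ σ.sent →
      Step σ { σ with inbox := Function.update σ.inbox r (insert p (σ.inbox r)) }
  /-- The primary assigns the next sequence number to a transaction and proposes it; its proposal
  counts as its prepare message. -/
  | propose (σ) (r) (k : ℕ) (T : Tx) : r ∉ R.byz → (σ.loc r).active = true →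
      R.IsPrimary r (σ.loc r).view → (σ.loc r).top < k →
      (∀ j d, (r, Msg.prepare (σ.loc r).view j d) ∈ σ.sent → j < k) →
      Eligible σ r T →
      Step σ (act σ r (σ.loc r)
        {.prePrepare (σ.loc r).view k T, .prepare (σ.loc r).view k (some T)})
  /-- A replica supports the first acceptable `k`-th proposal of its primary. -/
  | support (σ) (r) (i) (k : ℕ) (T : Tx) : r ∉ R.byz → (σ.loc r).active = true →
      R.IsPrimary (r.1, i) (σ.loc r).view →
      ((r.1, i), Msg.prePrepare (σ.loc r).view k T) ∈ σ.inbox r → (σ.loc r).top < k →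
      (∀ d, (r, Msg.prepare (σ.loc r).view k d) ∉ σ.sent) →
      Eligible σ r T →
      Step σ (act σ r (σ.loc r) {.prepare (σ.loc r).view k (some T)})
  /-- A replica with `nf` identical prepare messages is prepared and sends a commit message. -/
  | prepared (σ) (r) (k : ℕ) (d : Req Tx) : r ∉ R.byz → (σ.loc r).active = true →
      HasFrom σ r r.1 R.nf (fun m => m = .prepare (σ.loc r).view k d) →
      Step σ (act σ r (σ.loc r) {.commit (σ.loc r).view k d})
  /-- The transaction at sequence number `kmax + 1` is committed (`nf` identical commit messages),
  was not handled before, and its local data-items are free: lock them, and forward a cross-shard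
  transaction to the next shard.  Committed transactions for which this step is not yet possible
  are the pending ones. -/
  | lock (σ) (r) (v : ℕ) (T : Tx) (A : Finset (Fin R.n)) : r ∉ R.byz → R.nf ≤ A.card →
      (∀ i ∈ A, ((r.1, i), Msg.commit v ((σ.loc r).kmax + 1) (some T)) ∈ σ.inbox r) →
      (∀ j, (j, T) ∉ (σ.loc r).locks ∧ (j, T) ∉ (σ.loc r).log) →
      (∀ j T', (j, T') ∈ (σ.loc r).locks → ¬ R.ConflictAt r.1 T T') →
      Step σ (act σ r
        { σ.loc r with
          kmax := (σ.loc r).kmax + 1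
          locks := insert ((σ.loc r).kmax + 1, T) (σ.loc r).locks }
        {m | R.IsCross T ∧ m = .forward T v ((σ.loc r).kmax + 1) A})
  /-- The request committed at sequence number `kmax + 1` is null or a transaction that was handled
  before: nothing has to be done for it. -/
  | skip (σ) (r) (v : ℕ) (d : Req Tx) : r ∉ R.byz →
      HasFrom σ r r.1 R.nf (fun m => m = .commit v ((σ.loc r).kmax + 1) d) →
      (∀ T, d = some T → ∃ j, (j, T) ∈ (σ.loc r).locks ∨ (j, T) ∈ (σ.loc r).log) →
      Step σ (act σ r { σ.loc r with kmax := (σ.loc r).kmax + 1 } ∅)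
  /-- Execute a locked transaction, add it to the log, release its locks, and send an execute message
  to the next shard if the transaction is cross-shard. -/
  | execute (σ) (r) (k : ℕ) (T : Tx) : r ∉ R.byz → (k, T) ∈ (σ.loc r).locks →
      CanExecute σ r T →
      Step σ (act σ r
        { σ.loc r with
          locks := (σ.loc r).locks \ {(k, T)}
          log := (σ.loc r).log ++ [(k, T)] }
        {m | R.IsCross T ∧ m = .execute T})
  /-- A replica leaves its view (a timer expired, or other replicas asked for it) and reports
  all that it prepared and pre-prepared. -/
  | startViewChange (σ) (r) (v : ℕ) : r ∉ R.byz → (σ.loc r).view < v →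
      Step σ (act σ r { σ.loc r with view := v, active := false }
        {.viewChange v {e | (r, Msg.commit e.1 e.2.1 e.2.2) ∈ σ.sent}
          {e | (r, Msg.prepare e.1 e.2.1 e.2.2) ∈ σ.sent}})
  /-- The primary of a new view announces it, once. -/
  | sendNewView (σ) (r) (v : ℕ) (D) (P Q) (top : ℕ) (X) : r ∉ R.byz → R.IsPrimary r v →
      (σ.loc r).view = v → (σ.loc r).active = false →
      (∀ D' P' Q' top' X', (r, Msg.newView v D' P' Q' top' X') ∉ σ.sent) →
      ValidNewView σ r v D P Q top X →
      Step σ (act σ r (σ.loc r) {.newView v D P Q top X})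
  /-- A replica enters a new view and supports the requests that its new-view message chose. -/
  | enterView (σ) (r) (i) (v : ℕ) (D) (P Q) (top : ℕ) (X) : r ∉ R.byz →
      R.IsPrimary (r.1, i) v → ((r.1, i), Msg.newView v D P Q top X) ∈ σ.inbox r →
      ((σ.loc r).view < v ∨ ((σ.loc r).view = v ∧ (σ.loc r).active = false)) →
      ValidNewView σ r v D P Q top X →
      Step σ (act σ r { σ.loc r with view := v, active := true, top := top }
        {m | ∃ k, 1 ≤ k ∧ k ≤ top ∧ m = .prepare v k (X k)})

/-- States that occur in runs of the protocol. -/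
def Reachable (σ : State Shard Tx R.n) : Prop := Relation.ReflTransGen Step R.start σ

/-- Replica `r` has executed `T` as the `k`-th transaction of its shard. -/
def Executed (σ : State Shard Tx R.n) (r : Shard × Fin R.n) (k : ℕ) (T : Tx) : Prop :=
  (k, T) ∈ (σ.loc r).log

/-- Replica `r` has ordered `T` as the `k`-th transaction of its shard and acquired the locks for it
(which it holds until it executes `T`). -/
def Handled (σ : State Shard Tx R.n) (r : Shard × Fin R.n) (k : ℕ) (T : Tx) : Prop :=
  (k, T) ∈ (σ.loc r).locks ∨ (k, T) ∈ (σ.loc r).log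

/-- Replica `r` has executed `T` and, at a later time, `T'`. -/
def ExecutedBefore (σ : State Shard Tx R.n) (r : Shard × Fin R.n) (T T' : Tx) : Prop :=
  [T, T'].Sublist ((σ.loc r).log.map Prod.snd)

/-- Involvement: a transaction is executed only if every involved shard has processed it, and only
involved shards process it. -/
def Involvement (σ : State Shard Tx R.n) : Prop :=
  (∀ r k T, r ∉ R.byz → Executed σ r k T →
    ∀ s ∈ R.involved T, ∃ i j, (s, i) ∉ R.byz ∧ Handled σ (s, i) j T) ∧
  (∀ r k T, r ∉ R.byz → Handled σ r k T → r.1 ∈ R.involved T)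

/-- Non-divergence: non-faulty replicas of a shard execute the same `k`-th transaction. -/
def NonDivergence (σ : State Shard Tx R.n) : Prop :=
  ∀ s i j k T T', (s, i) ∉ R.byz → (s, j) ∉ R.byz →
    Executed σ (s, i) k T → Executed σ (s, j) k T' → T = T'

/-- Consistence: there is one order of all transactions in which every non-faulty replica of every
shard executes the conflicting transactions of its shard. -/
def Consistence (σ : State Shard Tx R.n) : Prop :=
  ∃ lt : Tx → Tx → Prop, IsStrictTotalOrder Tx lt ∧
    ∀ r T T', r ∉ R.byz → R.ConflictAt r.1 T T' → ExecutedBefore σ r T T' → lt T T'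

/-- All non-faulty replicas of a shard execute each transaction in the same order: a transaction
has the same sequence number at all of them, it is executed at most once by each, and conflicting
transactions are executed in the order of their sequence numbers. -/
def SameOrderInShard (σ : State Shard Tx R.n) : Prop :=
  (∀ s i j k k' T, (s, i) ∉ R.byz → (s, j) ∉ R.byz →
    Executed σ (s, i) k T → Executed σ (s, j) k' T → k = k') ∧
  (∀ r, r ∉ R.byz → ((σ.loc r).log.map Prod.snd).Nodup) ∧
  (∀ r k k' T T', r ∉ R.byz → R.ConflictAt r.1 T T' → Executed σ r k T → Executed σ r k' T' →
    (ExecutedBefore σ r T T' ↔ k < k'))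

/-- Conflicting transactions are executed in the same order by all non-faulty replicas of all
shards at which they conflict: if one of them executed `T` before `T'`, then each of them that has
executed `T'` executed `T` before it. -/
def SameOrderAcrossShards (σ : State Shard Tx R.n) : Prop :=
  ∀ r q T T', r ∉ R.byz → q ∉ R.byz → R.ConflictAt r.1 T T' → R.ConflictAt q.1 T T' →
    ExecutedBefore σ r T T' → (∃ k, Executed σ q k T') → ExecutedBefore σ q T T'

end Protocol

end RingBFT

namespace RingBFT

set_option linter.unusedSectionVars false

variable {Shard Item Tx : Type*} [LinearOrder Shard] {R : System Shard Item Tx}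

/-! ### Quorum intersection -/

section Quorums

/-! The proof combines agreement inside a shard, the two rotations around the ring, and locking.

Agreement is the PBFT argument. Any two quorums share a non-faulty replica, so two requests prepared
at one number in one view coincide. A committed request survives view changes: every admissible new
view rests on a quorum of reports that meets the commit quorum in a non-faulty replica, and
induction on views finishes (`prepare_eq_of_committed`, `Committed.unique`). Since replicas handle
committed requests in sequence, a transaction has one number per shard, and whoever handled number
`k'` had handled everything numbered below it (`Handled.number_unique`, `Handled.of_lt`).

The first rotation makes a shard process `T` only after all involved shards before it
(`Processed.of_le`). Hence once the last one has processed `T`, all have: `T` is then `Complete`.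
Every execution traces back, through Execute messages if necessary, to such a moment
(`Executed.complete`).

Locks tie the shards together. If `T` and `T'` conflict at a shard and `T` has the smaller number
there, a replica that handled `T'` had already executed `T` (`ReplicaInv.executed_of_lt`). So `T`
was complete before `T'` became complete. The time of completion does not depend on the shard, and
ranking transactions by it (`exists_isRank`) orders conflicts consistently everywhere. -/

theorem exists_honest_of_lt_card (hbyz : ∀ s : Shard, {i : Fin R.n | (s, i) ∈ R.byz}.ncard ≤ R.f)
    (s : Shard) (A : Finset (Fin R.n)) (hA : R.f + 1 ≤ A.card) : ∃ i ∈ A, (s, i) ∉ R.byz := by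
  by_contra! h
  have h1 : (A : Set (Fin R.n)) ⊆ {i : Fin R.n | (s, i) ∈ R.byz} := fun i hi => h i hi
  have h2 := Set.ncard_le_ncard h1 (Set.toFinite _)
  rw [Set.ncard_coe_finset] at h2
  have := hbyz s
  omega

theorem exists_honest_of_quorum (hn : 3 * R.f + 1 ≤ R.n)
    (hbyz : ∀ s : Shard, {i : Fin R.n | (s, i) ∈ R.byz}.ncard ≤ R.f)
    (s : Shard) (A : Finset (Fin R.n)) (hA : R.nf ≤ A.card) : ∃ i ∈ A, (s, i) ∉ R.byz := by
  refine exists_honest_of_lt_card hbyz s A ?_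
  unfold System.nf at hA
  omega

/-- By inclusion–exclusion the overlap has at least `2 * nf - n = n - 2 * f ≥ f + 1` members, one
more than can be byzantine. -/
theorem exists_honest_of_quorums (hn : 3 * R.f + 1 ≤ R.n)
    (hbyz : ∀ s : Shard, {i : Fin R.n | (s, i) ∈ R.byz}.ncard ≤ R.f)
    (s : Shard) (A B : Finset (Fin R.n)) (hA : R.nf ≤ A.card) (hB : R.nf ≤ B.card) :
    ∃ i, i ∈ A ∧ i ∈ B ∧ (s, i) ∉ R.byz := by
  have h1 := Finset.card_union_add_card_inter A B
  have h2 : (A ∪ B).card ≤ R.n := by simpa using Finset.card_le_univ (A ∪ B)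
  unfold System.nf at hA hB
  obtain ⟨i, hi, hb⟩ := exists_honest_of_lt_card hbyz s (A ∩ B) (by omega)
  rw [Finset.mem_inter] at hi
  exact ⟨i, hi.1, hi.2, hb⟩

end Quorums

/-! ### State updates and monotonicity of communication -/

section Act

variable (σ : State Shard Tx R.n) (r : Shard × Fin R.n) (l : Loc Tx) (ms : Set (Msg Tx R.n))

@[simp] theorem mem_act_sent (p) :
    p ∈ (act σ r l ms).sent ↔ p ∈ σ.sent ∨ (p.1 = r ∧ p.2 ∈ ms) := Iff.rfl

@[simp] theorem act_loc_self : (act σ r l ms).loc r = l := Function.update_self ..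

theorem act_loc_of_ne {q : Shard × Fin R.n} (h : q ≠ r) : (act σ r l ms).loc q = σ.loc q :=
  Function.update_of_ne h ..

end Act

/-- All communication of `σ` is still present in `τ`. -/
structure Extends (σ τ : State Shard Tx R.n) : Prop where
  requests : σ.requests ⊆ τ.requests
  sent : σ.sent ⊆ τ.sent
  inbox : ∀ r, σ.inbox r ⊆ τ.inbox r

theorem extends_act (σ : State Shard Tx R.n) (r : Shard × Fin R.n) (l : Loc Tx)
    (ms : Set (Msg Tx R.n)) : Extends σ (act σ r l ms) :=
  ⟨subset_rfl, fun _ h => Or.inl h, fun _ => subset_rfl⟩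

theorem Step.extends {σ τ : State Shard Tx R.n} (h : Step σ τ) : Extends σ τ := by
  cases h
  case clientRequest => exact ⟨Set.subset_insert _ _, subset_rfl, fun _ => subset_rfl⟩
  case byzantine => exact ⟨subset_rfl, Set.subset_insert _ _, fun _ => subset_rfl⟩
  case deliver r p hp =>
    refine ⟨subset_rfl, subset_rfl, fun q => ?_⟩
    by_cases hq : q = r
    · subst hq
      simp
    · simp [Function.update_of_ne hq]
  all_goals exact extends_act ..

/-- Only messages that were sent are received. -/
theorem Reachable.inbox_subset {σ : State Shard Tx R.n} (h : Reachable σ) (r : Shard × Fin R.n) :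
    σ.inbox r ⊆ σ.sent := by
  induction h with
  | refl => simp [System.start]
  | tail _ hs ih =>
    have he := hs.extends
    cases hs
    case deliver σ _ q p hp =>
      by_cases hq : r = q
      · subst hq
        simpa [Set.insert_subset_iff] using ⟨hp, ih⟩
      · simpa [Function.update_of_ne hq] using ih
    all_goals exact ih.trans he.sent

theorem HasFrom.mono {σ τ : State Shard Tx R.n} (h : Extends σ τ) {r : Shard × Fin R.n} {s : Shard}
    {c : ℕ} {p p' : Msg Tx R.n → Prop} (hp : ∀ m, p m → p' m) (hf : HasFrom σ r s c p) :
    HasFrom τ r s c p' := by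
  obtain ⟨A, hc, hA⟩ := hf
  refine ⟨A, hc, fun i hi => ?_⟩
  obtain ⟨m, hm, hin⟩ := hA i hi
  exact ⟨m, hp m hm, h.inbox r hin⟩

theorem ValidForward.mono {σ τ : State Shard Tx R.n} (h : Extends σ τ) {u : Shard} {T : Tx}
    {m : Msg Tx R.n} (hf : ValidForward σ u T m) : ValidForward τ u T m := by
  obtain ⟨v, k, A, hm, hc, hA⟩ := hf
  exact ⟨v, k, A, hm, hc, fun i hi => h.sent (hA i hi)⟩

theorem Eligible.mono {σ τ : State Shard Tx R.n} (h : Extends σ τ) {r : Shard × Fin R.n} {T : Tx}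
    (he : Eligible σ r T) : Eligible τ r T := by
  refine ⟨h.requests he.1, he.2.imp_right ?_⟩
  rintro ⟨hi, u, hu, hf⟩
  exact ⟨hi, u, hu, hf.mono h fun m hm => hm.mono h⟩

theorem ValidNewView.mono {σ τ : State Shard Tx R.n} (h : Extends σ τ) {r : Shard × Fin R.n}
    {v : ℕ} {D : Finset (Fin R.n)} {P Q : Fin R.n → Set (Entry Tx)} {top : ℕ} {X : ℕ → Req Tx}
    (hv : ValidNewView σ r v D P Q top X) : ValidNewView τ r v D P Q top X :=
  ⟨hv.1, fun i hi => h.inbox r (hv.2.1 i hi), hv.2.2⟩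

/-! ### Invariants of the consensus messages of one replica -/

/-- The reasons for which a non-faulty replica `q` supports request `d` at `k` in view `v`. -/
def Justified (σ : State Shard Tx R.n) (q : Shard × Fin R.n) (v k : ℕ) (d : Req Tx) : Prop :=
  (∃ T, d = some T ∧ Eligible σ q T ∧
    (v = 0 ∨ ∃ D P Q top X, ValidNewView σ q v D P Q top X ∧ top < k)) ∨
  ∃ D P Q top X, ValidNewView σ q v D P Q top X ∧ 1 ≤ k ∧ k ≤ top ∧ d = X k

theorem Justified.mono {σ τ : State Shard Tx R.n} (h : Extends σ τ) {q : Shard × Fin R.n}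
    {v k : ℕ} {d : Req Tx} (hj : Justified σ q v k d) : Justified τ q v k d := by
  rcases hj with ⟨T, hT, he, hv⟩ | ⟨D, P, Q, top, X, hv, hk⟩
  · refine Or.inl ⟨T, hT, he.mono h, hv.imp_right ?_⟩
    rintro ⟨D, P, Q, top, X, hv, hk⟩
    exact ⟨D, P, Q, top, X, hv.mono h, hk⟩
  · exact Or.inr ⟨D, P, Q, top, X, hv.mono h, hk⟩

/-- A quorum of replicas of `s` sent the message `m`. -/
def QuorumSent (σ : State Shard Tx R.n) (s : Shard) (m : Msg Tx R.n) : Prop :=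
  ∃ A : Finset (Fin R.n), R.nf ≤ A.card ∧ ∀ i ∈ A, ((s, i), m) ∈ σ.sent

theorem QuorumSent.mono {σ τ : State Shard Tx R.n} (h : Extends σ τ) {s : Shard} {m : Msg Tx R.n}
    (hq : QuorumSent σ s m) : QuorumSent τ s m := by
  obtain ⟨A, hc, hA⟩ := hq
  exact ⟨A, hc, fun i hi => h.sent (hA i hi)⟩

theorem HasFrom.quorumSent {σ : State Shard Tx R.n} (hin : ∀ r, σ.inbox r ⊆ σ.sent)
    {r : Shard × Fin R.n} {s : Shard} {m : Msg Tx R.n} (h : HasFrom σ r s R.nf (fun m' => m' = m)) :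
    QuorumSent σ s m := by
  obtain ⟨A, hc, hA⟩ := h
  refine ⟨A, hc, fun i hi => ?_⟩
  obtain ⟨_, rfl, hm⟩ := hA i hi
  exact hin r hm

/-- What holds about the consensus messages of a non-faulty replica `q`. -/
structure ConsensusInv (σ : State Shard Tx R.n) (q : Shard × Fin R.n) : Prop where
  prepare_view : ∀ v k d, (q, Msg.prepare v k d) ∈ σ.sent →
    v ≤ (σ.loc q).view ∧ (v = (σ.loc q).view → (σ.loc q).active = true)
  prepare_unique : ∀ v k d d', (q, Msg.prepare v k d) ∈ σ.sent →
    (q, Msg.prepare v k d') ∈ σ.sent → d = d'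
  prepare_justified : ∀ v k d, (q, Msg.prepare v k d) ∈ σ.sent → Justified σ q v k d
  commit_prepared : ∀ v k d, (q, Msg.commit v k d) ∈ σ.sent →
    QuorumSent σ q.1 (.prepare v k d)
  viewChange_view : ∀ v P Q, (q, Msg.viewChange v P Q) ∈ σ.sent → v ≤ (σ.loc q).view
  viewChange_commits : ∀ v P Q w k d, (q, Msg.viewChange v P Q) ∈ σ.sent →
    (q, Msg.commit w k d) ∈ σ.sent → w < v → (w, k, d) ∈ P
  viewChange_prepares : ∀ v P Q w k d, (q, Msg.viewChange v P Q) ∈ σ.sent →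
    (w, k, d) ∈ Q → (q, Msg.prepare w k d) ∈ σ.sent
  active_newView : (σ.loc q).active = true → (σ.loc q).view = 0 ∨
    ∃ D P Q X, ValidNewView σ q (σ.loc q).view D P Q (σ.loc q).top X

/-- Certificates in the invariant are monotone in the communication; the other clauses involve only
the view data of `q` and its own prepare, commit and view-change messages. -/
theorem ConsensusInv.of_unchanged {σ τ : State Shard Tx R.n} (h : Extends σ τ)
    {q : Shard × Fin R.n} (hi : ConsensusInv σ q)
    (hview : (τ.loc q).view = (σ.loc q).view) (hact : (τ.loc q).active = (σ.loc q).active)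
    (htop : (τ.loc q).top = (σ.loc q).top)
    (hp : ∀ v k d, (q, Msg.prepare v k d) ∈ τ.sent → (q, Msg.prepare v k d) ∈ σ.sent)
    (hc : ∀ v k d, (q, Msg.commit v k d) ∈ τ.sent → (q, Msg.commit v k d) ∈ σ.sent)
    (hv : ∀ v P Q, (q, Msg.viewChange v P Q) ∈ τ.sent → (q, Msg.viewChange v P Q) ∈ σ.sent) :
    ConsensusInv τ q where
  prepare_view v k d hm := by
    rw [hview, hact]
    exact hi.prepare_view v k d (hp _ _ _ hm)
  prepare_unique v k d d' hm hm' := hi.prepare_unique v k d d' (hp _ _ _ hm) (hp _ _ _ hm')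
  prepare_justified v k d hm := (hi.prepare_justified v k d (hp _ _ _ hm)).mono h
  commit_prepared v k d hm := (hi.commit_prepared v k d (hc _ _ _ hm)).mono h
  viewChange_view v P Q hm := hview ▸ hi.viewChange_view v P Q (hv _ _ _ hm)
  viewChange_commits v P Q w k d hm hm' :=
    hi.viewChange_commits v P Q w k d (hv _ _ _ hm) (hc _ _ _ hm')
  viewChange_prepares v P Q w k d hm hm' :=
    h.sent (hi.viewChange_prepares v P Q w k d (hv _ _ _ hm) hm')
  active_newView ha := by
    rw [hview, htop]
    refine (hi.active_newView (hact ▸ ha)).imp_right ?_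
    rintro ⟨D, P, Q, X, hx⟩
    exact ⟨D, P, Q, X, hx.mono h⟩

/-- Supporting a fresh request preserves the invariant. -/
theorem ConsensusInv.of_prepare {σ : State Shard Tx R.n} {q : Shard × Fin R.n}
    (hi : ConsensusInv σ q) {k : ℕ} {T : Tx} {ms : Set (Msg Tx R.n)}
    (hact : (σ.loc q).active = true) (htop : (σ.loc q).top < k)
    (hnew : ∀ d, (q, Msg.prepare (σ.loc q).view k d) ∉ σ.sent) (he : Eligible σ q T)
    (hp : ∀ v j d, Msg.prepare v j d ∈ ms → v = (σ.loc q).view ∧ j = k ∧ d = some T)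
    (hc : ∀ v j d, Msg.commit v j d ∉ ms) (hv : ∀ v P Q, Msg.viewChange v P Q ∉ ms) :
    ConsensusInv (act σ q (σ.loc q) ms) q := by
  have hx := extends_act σ q (σ.loc q) ms
  refine ⟨?_, ?_, ?_, ?_, ?_, ?_, ?_, ?_⟩
  · rintro v j d (hm | ⟨-, hm⟩)
    · simpa using hi.prepare_view v j d hm
    · obtain ⟨rfl, rfl, rfl⟩ := hp _ _ _ hm
      simpa using hact
  · rintro v j d d' (hm | ⟨-, hm⟩) (hm' | ⟨-, hm'⟩)
    · exact hi.prepare_unique v j d d' hm hm'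
    · obtain ⟨rfl, rfl, rfl⟩ := hp _ _ _ hm'
      exact absurd hm (hnew _)
    · obtain ⟨rfl, rfl, rfl⟩ := hp _ _ _ hm
      exact absurd hm' (hnew _)
    · rw [(hp _ _ _ hm).2.2, (hp _ _ _ hm').2.2]
  · rintro v j d (hm | ⟨-, hm⟩)
    · exact (hi.prepare_justified v j d hm).mono hx
    · obtain ⟨rfl, rfl, rfl⟩ := hp _ _ _ hm
      -- Outside view `0`, the new-view certificate behind the active view covers numbers up to the
      -- current `top`, and a fresh number lies above it.
      refine Or.inl ⟨T, rfl, he.mono hx, (hi.active_newView hact).imp_right ?_⟩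
      rintro ⟨D, P, Q, X, hnv⟩
      exact ⟨D, P, Q, _, X, hnv.mono hx, htop⟩
  · rintro v j d (hm | ⟨-, hm⟩)
    · exact (hi.commit_prepared v j d hm).mono hx
    · exact absurd hm (hc _ _ _)
  · rintro v P Q (hm | ⟨-, hm⟩)
    · simpa using hi.viewChange_view v P Q hm
    · exact absurd hm (hv _ _ _)
  · rintro v P Q w j d (hm | ⟨-, hm⟩) (hm' | ⟨-, hm'⟩)
    · exact hi.viewChange_commits v P Q w j d hm hm'
    · exact absurd hm' (hc _ _ _)
    · exact absurd hm (hv _ _ _)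
    · exact absurd hm (hv _ _ _)
  · rintro v P Q w j d (hm | ⟨-, hm⟩) hm'
    · exact Or.inl (hi.viewChange_prepares v P Q w j d hm hm')
    · exact absurd hm (hv _ _ _)
  · intro ha
    rw [act_loc_self] at ha ⊢
    refine (hi.active_newView ha).imp_right ?_
    rintro ⟨D, P, Q, X, hnv⟩
    exact ⟨D, P, Q, X, hnv.mono hx⟩

/-- The delicate clause is `viewChange_commits`: the new commit belongs to the current view, and no
view-change message sent so far is for a larger one, so none had to report it. -/
theorem ConsensusInv.prepared {σ : State Shard Tx R.n} {q : Shard × Fin R.n}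
    (hin : ∀ r, σ.inbox r ⊆ σ.sent) (hi : ConsensusInv σ q) {k : ℕ} {d : Req Tx}
    (hq : HasFrom σ q q.1 R.nf (fun m => m = .prepare (σ.loc q).view k d)) :
    ConsensusInv (act σ q (σ.loc q) {.commit (σ.loc q).view k d}) q := by
  have hx := extends_act σ q (σ.loc q) {.commit (σ.loc q).view k d}
  refine ⟨?_, ?_, ?_, ?_, ?_, ?_, ?_, ?_⟩
  · simpa using hi.prepare_view
  · simpa using hi.prepare_unique
  · rintro v j e (hm | ⟨-, hm⟩)
    · exact (hi.prepare_justified v j e hm).mono hx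
    · simp at hm
  · rintro v j e (hm | ⟨-, hm⟩)
    · exact (hi.commit_prepared v j e hm).mono hx
    · cases hm
      exact (hq.quorumSent hin).mono hx
  · simpa using hi.viewChange_view
  · rintro v P Q w j e (hm | ⟨-, hm⟩) (hm' | ⟨-, hm'⟩) hw
    · exact hi.viewChange_commits v P Q w j e hm hm' hw
    · cases hm'
      exact absurd (hi.viewChange_view v P Q hm) (by omega)
    · simp at hm
    · simp at hm
  · simpa using hi.viewChange_prepares
  · intro ha
    rw [act_loc_self] at ha ⊢
    refine (hi.active_newView ha).imp_right ?_
    rintro ⟨D, P, Q, X, hnv⟩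
    exact ⟨D, P, Q, X, hnv.mono hx⟩

theorem ConsensusInv.startViewChange {σ : State Shard Tx R.n} {q : Shard × Fin R.n}
    (hi : ConsensusInv σ q) {v : ℕ} (hv : (σ.loc q).view < v) :
    ConsensusInv (act σ q { σ.loc q with view := v, active := false }
        {.viewChange v {e | (q, Msg.commit e.1 e.2.1 e.2.2) ∈ σ.sent}
          {e | (q, Msg.prepare e.1 e.2.1 e.2.2) ∈ σ.sent}}) q := by
  have hx := extends_act σ q { σ.loc q with view := v, active := false }
        {.viewChange v {e | (q, Msg.commit e.1 e.2.1 e.2.2) ∈ σ.sent}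
          {e | (q, Msg.prepare e.1 e.2.1 e.2.2) ∈ σ.sent}}
  refine ⟨?_, ?_, ?_, ?_, ?_, ?_, ?_, ?_⟩
  · rintro w j e (hm | ⟨-, hm⟩)
    · have := (hi.prepare_view w j e hm).1
      rw [act_loc_self]
      exact ⟨by simp only; omega, by simp only; omega⟩
    · simp at hm
  · simpa using hi.prepare_unique
  · rintro w j e (hm | ⟨-, hm⟩)
    · exact (hi.prepare_justified w j e hm).mono hx
    · simp at hm
  · rintro w j e (hm | ⟨-, hm⟩)
    · exact (hi.commit_prepared w j e hm).mono hx
    · simp at hm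
  · rintro w P Q (hm | ⟨-, hm⟩)
    · have := hi.viewChange_view w P Q hm
      rw [act_loc_self]
      simp only
      omega
    · cases hm
      simp
  · rintro w P Q u j e (hm | ⟨-, hm⟩) (hm' | ⟨-, hm'⟩) hw
    · exact hi.viewChange_commits w P Q u j e hm hm' hw
    · simp at hm'
    · cases hm
      exact hm'
    · simp at hm'
  · rintro w P Q u j e (hm | ⟨-, hm⟩) hm'
    · exact Or.inl (hi.viewChange_prepares w P Q u j e hm hm')
    · cases hm
      exact Or.inl hm'
  · simp

theorem ConsensusInv.enterView {σ : State Shard Tx R.n} {q : Shard × Fin R.n}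
    (hi : ConsensusInv σ q) {v : ℕ} {D : Finset (Fin R.n)} {P Q : Fin R.n → Set (Entry Tx)}
    {top : ℕ} {X : ℕ → Req Tx}
    (hv : (σ.loc q).view < v ∨ ((σ.loc q).view = v ∧ (σ.loc q).active = false))
    (hnv : ValidNewView σ q v D P Q top X) :
    ConsensusInv (act σ q { σ.loc q with view := v, active := true, top := top }
        {m | ∃ k, 1 ≤ k ∧ k ≤ top ∧ m = .prepare v k (X k)}) q := by
  have hx := extends_act σ q { σ.loc q with view := v, active := true, top := top }
        {m | ∃ k, 1 ≤ k ∧ k ≤ top ∧ m = .prepare v k (X k)}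
  have hle : (σ.loc q).view ≤ v := by omega
  -- Nothing was supported in view `v` yet: it is either above the current view, or current but
  -- inactive, whereas a prepare in the current view forces it to be active. Uniqueness then reduces
  -- to `X` being a function.
  have hnone : ∀ k d, (q, Msg.prepare v k d) ∉ σ.sent := by
    intro k d hm
    have h1 := hi.prepare_view v k d hm
    rcases hv with hv | ⟨hv, ha⟩
    · omega
    · simp [h1.2 hv.symm] at ha
  refine ⟨?_, ?_, ?_, ?_, ?_, ?_, ?_, ?_⟩
  · rintro w j e (hm | ⟨-, hm⟩)
    · have := (hi.prepare_view w j e hm).1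
      rw [act_loc_self]
      exact ⟨by simp only; omega, fun _ => rfl⟩
    · obtain ⟨k, -, -, hk⟩ := hm
      cases hk
      simp
  · rintro w j e e' (hm | ⟨-, hm⟩) (hm' | ⟨-, hm'⟩)
    · exact hi.prepare_unique w j e e' hm hm'
    · obtain ⟨k, -, -, hk⟩ := hm'
      cases hk
      exact absurd hm (hnone _ _)
    · obtain ⟨k, -, -, hk⟩ := hm
      cases hk
      exact absurd hm' (hnone _ _)
    · obtain ⟨k, -, -, hk⟩ := hm
      obtain ⟨k', -, -, hk'⟩ := hm'
      cases hk
      cases hk'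
      rfl
  · rintro w j e (hm | ⟨-, hm⟩)
    · exact (hi.prepare_justified w j e hm).mono hx
    · obtain ⟨k, hk1, hk2, hk⟩ := hm
      cases hk
      exact Or.inr ⟨D, P, Q, top, X, hnv.mono hx, hk1, hk2, rfl⟩
  · rintro w j e (hm | ⟨-, hm⟩)
    · exact (hi.commit_prepared w j e hm).mono hx
    · simp at hm
  · rintro w P Q (hm | ⟨-, hm⟩)
    · have := hi.viewChange_view w P Q hm
      rw [act_loc_self]
      exact this.trans hle
    · simp at hm
  · simpa using hi.viewChange_commits
  · rintro w P Q u j e (hm | ⟨-, hm⟩) hm'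
    · exact Or.inl (hi.viewChange_prepares w P Q u j e hm hm')
    · simp at hm
  · intro _
    rw [act_loc_self]
    exact Or.inr ⟨D, P, Q, X, hnv.mono hx⟩

theorem ConsensusInv.of_ne {σ : State Shard Tx R.n} {q r : Shard × Fin R.n} (hne : q ≠ r)
    (hi : ConsensusInv σ q) (l : Loc Tx) (ms : Set (Msg Tx R.n)) :
    ConsensusInv (act σ r l ms) q := by
  refine hi.of_unchanged (extends_act ..) ?_ ?_ ?_ ?_ ?_ ?_ <;> simp [act_loc_of_ne _ _ _ _ hne, hne]

theorem ConsensusInv.step {σ τ : State Shard Tx R.n} (hin : ∀ r, σ.inbox r ⊆ σ.sent)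
    {q : Shard × Fin R.n} (hq : q ∉ R.byz) (hi : ConsensusInv σ q) (hs : Step σ τ) :
    ConsensusInv τ q := by
  have he := hs.extends
  cases hs
  case clientRequest => exact hi.of_unchanged he rfl rfl rfl (by simp) (by simp) (by simp)
  case deliver => exact hi.of_unchanged he rfl rfl rfl (by simp) (by simp) (by simp)
  case byzantine r m hr =>
    have hne : q ≠ r := fun h => hq (h ▸ hr)
    exact hi.of_unchanged he rfl rfl rfl (by simp [hne]) (by simp [hne]) (by simp [hne])
  case propose r k T _ hact _ htop hnew hel =>
    by_cases hr : q = r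
    · subst hr
      refine hi.of_prepare hact htop (fun d hd => ?_) hel ?_ (by simp) (by simp)
      · exact absurd (hnew k d hd) (lt_irrefl _)
      · simp
    · exact hi.of_ne hr _ _
  case support r i k T _ hact _ _ htop hnew hel =>
    by_cases hr : q = r
    · subst hr
      exact hi.of_prepare hact htop hnew hel (by simp) (by simp) (by simp)
    · exact hi.of_ne hr _ _
  case prepared r k d _ _ hf =>
    by_cases hr : q = r
    · subst hr
      exact hi.prepared hin hf
    · exact hi.of_ne hr _ _
  case startViewChange r v _ hv =>
    by_cases hr : q = r
    · subst hr
      exact hi.startViewChange hv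
    · exact hi.of_ne hr _ _
  case enterView r i v D P Q top X _ _ _ hv hnv =>
    by_cases hr : q = r
    · subst hr
      exact hi.enterView hv hnv
    · exact hi.of_ne hr _ _
  case lock r v T A _ _ _ _ _ =>
    by_cases hr : q = r
    · subst hr
      refine hi.of_unchanged he ?_ ?_ ?_ ?_ ?_ ?_ <;> simp
    · exact hi.of_ne hr _ _
  case skip r v d _ _ _ =>
    by_cases hr : q = r
    · subst hr
      refine hi.of_unchanged he ?_ ?_ ?_ ?_ ?_ ?_ <;> simp
    · exact hi.of_ne hr _ _
  case execute r k T _ _ _ =>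
    by_cases hr : q = r
    · subst hr
      refine hi.of_unchanged he ?_ ?_ ?_ ?_ ?_ ?_ <;> simp
    · exact hi.of_ne hr _ _
  case sendNewView r v D P Q top X _ _ _ _ _ _ =>
    by_cases hr : q = r
    · subst hr
      refine hi.of_unchanged he ?_ ?_ ?_ ?_ ?_ ?_ <;> simp
    · exact hi.of_ne hr _ _

theorem Reachable.consensusInv {σ : State Shard Tx R.n} (h : Reachable σ) {q : Shard × Fin R.n}
    (hq : q ∉ R.byz) : ConsensusInv σ q := by
  induction h with
  | refl => constructor <;> simp [System.start]
  | tail hr hs ih => exact ih.step (Reachable.inbox_subset hr) hq hs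

/-! ### Agreement within a shard across view changes -/

section Agreement

variable (hn : 3 * R.f + 1 ≤ R.n)
  (hbyz : ∀ s : Shard, {i : Fin R.n | (s, i) ∈ R.byz}.ncard ≤ R.f)
  {σ : State Shard Tx R.n} (hσ : Reachable σ)

/-- Request `d` is committed at `k` in view `v` of shard `s`. -/
def Committed (σ : State Shard Tx R.n) (s : Shard) (k : ℕ) (d : Req Tx) : Prop :=
  ∃ v, QuorumSent σ s (.commit v k d)

theorem Committed.mono {σ τ : State Shard Tx R.n} (h : Extends σ τ) {s : Shard} {k : ℕ}
    {d : Req Tx} : Committed σ s k d → Committed τ s k d :=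
  fun ⟨v, hv⟩ => ⟨v, hv.mono h⟩

include hn hbyz hσ

/-- A quorum that prepared nothing for `k` contradicts a commit at `k` in an earlier view. -/
theorem not_nonePrepared {s : Shard} {v w k : ℕ} {d : Req Tx} {D : Finset (Fin R.n)}
    {P Q : Fin R.n → Set (Entry Tx)} (hc : QuorumSent σ s (.commit v k d)) (hvw : v < w)
    (hD : ∀ i ∈ D, ((s, i), Msg.viewChange w (P i) (Q i)) ∈ σ.sent) :
    ¬ R.NonePrepared D P k := by
  rintro ⟨A, hAD, hA, hnone⟩
  obtain ⟨B, hB, hcom⟩ := hc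
  obtain ⟨i, hiA, hiB, hi⟩ := exists_honest_of_quorums hn hbyz s A B hA hB
  exact hnone i hiA v d
    ((hσ.consensusInv hi).viewChange_commits w _ _ v k d (hD i (hAD hiA)) (hcom i hiB) hvw)

/-- Once a request is committed, non-faulty replicas support no other one in later views. -/
theorem prepare_eq_of_committed {s : Shard} {v k : ℕ} {d : Req Tx}
    (hc : QuorumSent σ s (.commit v k d)) (w : ℕ) (hvw : v < w) (j : Fin R.n)
    (hj : (s, j) ∉ R.byz) (d' : Req Tx) (hp : ((s, j), Msg.prepare w k d') ∈ σ.sent) :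
    d' = d := by
  induction w using Nat.strong_induction_on generalizing j d' with
  | _ w ih =>
  have hnone {D P Q top X} (hnv : ValidNewView σ (s, j) w D P Q top X) : ¬ R.NonePrepared D P k :=
    not_nonePrepared hn hbyz hσ hc hvw fun i hi => hσ.inbox_subset _ (hnv.2.1 i hi)
  rcases (hσ.consensusInv hj).prepare_justified w k d' hp with
    ⟨T, -, -, h0 | ⟨D, P, Q, top, X, hnv, hk⟩⟩ | ⟨D, P, Q, top, X, hnv, hk1, hk2, rfl⟩
  -- A commit in an earlier view rules out `w = 0`.
  · omega
  -- A fresh proposal lies above `top`, where the new view certifies that a quorum prepared nothing.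
  · exact absurd (hnv.2.2.2.2 k hk) (hnone hnv)
  · rcases hnv.2.2.2.1 k hk1 hk2 with hch | ⟨-, hno⟩
    · obtain ⟨u, -, ⟨A, hAD, hA, hAu⟩, B, hBD, hB, hBu⟩ := hch
      have hvc (i) (hi : i ∈ D) := hσ.inbox_subset _ (hnv.2.1 i hi)
      obtain ⟨C, hC, hcom⟩ := id hc
      obtain ⟨i, hiA, hiC, hi⟩ := exists_honest_of_quorums hn hbyz s A C hA hC
      have hiP := (hσ.consensusInv hi).viewChange_commits w _ _ v k d (hvc i (hAD hiA))
        (hcom i hiC) hvw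
      -- The common replica `i` reported `d` at view `v`, so the chosen request has view `u > v`, or
      -- `u = v` and it is `d`. In the former case a non-faulty pre-preparer supported it in some
      -- `u'` with `v < u' < w`, and induction applies.
      rcases hAu i hiA v d hiP with hlt | ⟨-, hd⟩
      · obtain ⟨b, hbB, hb⟩ := exists_honest_of_lt_card hbyz s B hB
        obtain ⟨u', huu', hbQ⟩ := hBu b hbB
        have hu' : u' < w := hnv.2.2.1 b (hBD hbB) _ (Or.inr hbQ)
        exact ih u' hu' (by omega) b hb _
          ((hσ.consensusInv hb).viewChange_prepares w _ _ u' k _ (hvc b (hBD hbB)) hbQ)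
      · exact hd.symm
    · exact absurd hno (hnone hnv)

/-- Two requests committed in one shard at the same sequence number coincide. -/
theorem Committed.unique {s : Shard} {k : ℕ} {d d' : Req Tx} (h : Committed σ s k d)
    (h' : Committed σ s k d') : d = d' := by
  obtain ⟨v, hv⟩ := h
  obtain ⟨v', hv'⟩ := h'
  wlog hle : v ≤ v' generalizing v v' d d'
  · exact (this v' hv' v hv (by omega)).symm
  have hq {u e} (hu : QuorumSent σ s (.commit u k e)) : QuorumSent σ s (.prepare u k e) := by
    obtain ⟨A, hA, hcom⟩ := hu
    obtain ⟨i, hiA, hi⟩ := exists_honest_of_quorum hn hbyz s A hA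
    exact (hσ.consensusInv hi).commit_prepared _ _ _ (hcom i hiA)
  obtain ⟨A, hA, hpA⟩ := hq hv
  obtain ⟨B, hB, hpB⟩ := hq hv'
  obtain ⟨i, hiA, hiB, hi⟩ := exists_honest_of_quorums hn hbyz s A B hA hB
  rcases hle.eq_or_lt with rfl | hlt
  · exact (hσ.consensusInv hi).prepare_unique v k d d' (hpA i hiA) (hpB i hiB)
  · exact (prepare_eq_of_committed hn hbyz hσ hv v' hlt i hi d' (hpB i hiB)).symm

/-- If a non-faulty replica supports a transaction, some non-faulty replica of the shard was
eligible to do so. -/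
theorem exists_eligible_of_prepare {s : Shard} {k : ℕ} {T : Tx} (w : ℕ) (j : Fin R.n)
    (hj : (s, j) ∉ R.byz) (hp : ((s, j), Msg.prepare w k (some T)) ∈ σ.sent) :
    ∃ i, (s, i) ∉ R.byz ∧ Eligible σ (s, i) T := by
  induction w using Nat.strong_induction_on generalizing j with
  | _ w ih =>
  rcases (hσ.consensusInv hj).prepare_justified w k _ hp with
    ⟨T', hT, he, -⟩ | ⟨D, P, Q, top, X, hnv, hk1, hk2, hX⟩
  · cases hT
    exact ⟨j, hj, he⟩
  -- Among the `f + 1` replicas reporting a chosen request is a non-faulty one that supported it in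
  -- an earlier view; the descent must end at a fresh proposal.
  · rcases hnv.2.2.2.1 k hk1 hk2 with ⟨u, -, -, B, hBD, hB, hBu⟩ | ⟨hno, -⟩
    · obtain ⟨b, hbB, hb⟩ := exists_honest_of_lt_card hbyz s B hB
      obtain ⟨u', -, hbQ⟩ := hBu b hbB
      have hu' : u' < w := hnv.2.2.1 b (hBD hbB) _ (Or.inr hbQ)
      rw [← hX] at hbQ
      exact ih u' hu' b hb ((hσ.consensusInv hb).viewChange_prepares w _ _ u' k _
        (hσ.inbox_subset _ (hnv.2.1 b (hBD hbB))) hbQ)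
    · simp [← hX] at hno

theorem Committed.exists_eligible {s : Shard} {k : ℕ} {T : Tx} (h : Committed σ s k (some T)) :
    ∃ i, (s, i) ∉ R.byz ∧ Eligible σ (s, i) T := by
  obtain ⟨v, A, hA, hcom⟩ := h
  obtain ⟨i, hiA, hi⟩ := exists_honest_of_quorum hn hbyz s A hA
  obtain ⟨B, hB, hpB⟩ := (hσ.consensusInv hi).commit_prepared _ _ _ (hcom i hiA)
  obtain ⟨j, hjB, hj⟩ := exists_honest_of_quorum hn hbyz s B hB
  exact exists_eligible_of_prepare hn hbyz hσ v j hj (hpB j hjB)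

end Agreement

/-! ### Locks, logs and sequence numbers of one replica -/

theorem System.ConflictAt.symm {s : Shard} {T T' : Tx} (h : R.ConflictAt s T T') :
    R.ConflictAt s T' T := by
  obtain ⟨x, hx, h1, h2⟩ := h
  exact ⟨x, hx, h2, h1⟩

/-- What holds about the transactions that a non-faulty replica `q` handled. -/
structure ReplicaInv (σ : State Shard Tx R.n) (q : Shard × Fin R.n) : Prop where
  bounds : ∀ k T, Handled σ q k T → 1 ≤ k ∧ k ≤ (σ.loc q).kmax
  committed : ∀ k T, Handled σ q k T → Committed σ q.1 k (some T)
  covered : ∀ k, 1 ≤ k → k ≤ (σ.loc q).kmax → ∃ d, Committed σ q.1 k d ∧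
    ∀ T, d = some T → ∃ j ≤ k, Handled σ q j T
  unique : ∀ k k' T, Handled σ q k T → Handled σ q k' T → k = k'
  disjoint : ∀ k k' T, (k, T) ∈ (σ.loc q).locks → (k', T) ∉ (σ.loc q).log
  nodup : ((σ.loc q).log.map Prod.snd).Nodup
  locks_conflict : ∀ k k' T T', (k, T) ∈ (σ.loc q).locks → (k', T') ∈ (σ.loc q).locks →
    R.ConflictAt q.1 T T' → T = T'
  lock_order : ∀ k k' T T', (k, T) ∈ (σ.loc q).log → (k', T') ∈ (σ.loc q).locks →
    R.ConflictAt q.1 T T' → k < k'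
  log_order : (σ.loc q).log.Pairwise fun a b => R.ConflictAt q.1 a.2 b.2 → a.1 < b.1
  forward_handled : ∀ T v k A, (q, Msg.forward T v k A) ∈ σ.sent → ∃ j, Handled σ q j T
  execute_executed : ∀ T, (q, Msg.execute T) ∈ σ.sent → ∃ j, Executed σ q j T

theorem ReplicaInv.of_unchanged {σ τ : State Shard Tx R.n} (h : Extends σ τ)
    {q : Shard × Fin R.n} (hi : ReplicaInv σ q)
    (hlocks : (τ.loc q).locks = (σ.loc q).locks) (hlog : (τ.loc q).log = (σ.loc q).log)
    (hkmax : (τ.loc q).kmax = (σ.loc q).kmax)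
    (hf : ∀ T v k A, (q, Msg.forward T v k A) ∈ τ.sent → (q, Msg.forward T v k A) ∈ σ.sent)
    (he : ∀ T, (q, Msg.execute T) ∈ τ.sent → (q, Msg.execute T) ∈ σ.sent) :
    ReplicaInv τ q := by
  have hh : ∀ k T, Handled τ q k T ↔ Handled σ q k T := by simp [Handled, hlocks, hlog]
  refine ⟨?_, ?_, ?_, ?_, ?_, ?_, ?_, ?_, ?_, ?_, ?_⟩
  · simpa only [hh, hkmax] using hi.bounds
  · exact fun k T hk => (hi.committed k T ((hh k T).1 hk)).mono h
  · intro k h1 h2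
    obtain ⟨d, hd, hdT⟩ := hi.covered k h1 (hkmax ▸ h2)
    exact ⟨d, hd.mono h, by simpa only [hh] using hdT⟩
  · simpa only [hh] using hi.unique
  · simpa only [hlocks, hlog] using hi.disjoint
  · simpa only [hlog] using hi.nodup
  · simpa only [hlocks] using hi.locks_conflict
  · simpa only [hlocks, hlog] using hi.lock_order
  · simpa only [hlog] using hi.log_order
  · intro T v k A hm
    simpa only [hh] using hi.forward_handled T v k A (hf _ _ _ _ hm)
  · intro T hm
    simpa only [Executed, hlog] using hi.execute_executed T (he _ hm)

/-- The new number exceeds every handled one, which yields `lock_order`; the items are free, which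
yields `locks_conflict`. -/
theorem ReplicaInv.lock {σ : State Shard Tx R.n} {q : Shard × Fin R.n} (hi : ReplicaInv σ q)
    {v : ℕ} {T : Tx} {A : Finset (Fin R.n)}
    (hc : Committed σ q.1 ((σ.loc q).kmax + 1) (some T))
    (hnew : ∀ j, (j, T) ∉ (σ.loc q).locks ∧ (j, T) ∉ (σ.loc q).log)
    (hfree : ∀ j T', (j, T') ∈ (σ.loc q).locks → ¬ R.ConflictAt q.1 T T') :
    ReplicaInv (act σ q { σ.loc q with
          kmax := (σ.loc q).kmax + 1
          locks := insert ((σ.loc q).kmax + 1, T) (σ.loc q).locks }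
        {m | R.IsCross T ∧ m = .forward T v ((σ.loc q).kmax + 1) A}) q := by
  set τ := act σ q { σ.loc q with
          kmax := (σ.loc q).kmax + 1
          locks := insert ((σ.loc q).kmax + 1, T) (σ.loc q).locks }
        {m | R.IsCross T ∧ m = .forward T v ((σ.loc q).kmax + 1) A} with hτ
  have hx : Extends σ τ := extends_act ..
  have hloc : τ.loc q = { σ.loc q with
          kmax := (σ.loc q).kmax + 1
          locks := insert ((σ.loc q).kmax + 1, T) (σ.loc q).locks } := act_loc_self ..
  have hh : ∀ k T', Handled τ q k T' ↔ (k = (σ.loc q).kmax + 1 ∧ T' = T) ∨ Handled σ q k T' := by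
    intro k T'
    simp [Handled, hloc, or_assoc]
  have hno : ∀ j, ¬ Handled σ q j T := fun j hj => hj.elim (hnew j).1 (hnew j).2
  refine ⟨?_, ?_, ?_, ?_, ?_, ?_, ?_, ?_, ?_, ?_, ?_⟩
  · intro k T' hk
    rw [hloc]
    rcases (hh k T').1 hk with ⟨rfl, rfl⟩ | hk
    · simp
    · have := hi.bounds k T' hk
      exact ⟨this.1, by simp only; omega⟩
  · intro k T' hk
    rcases (hh k T').1 hk with ⟨rfl, rfl⟩ | hk
    · exact hc.mono hx
    · exact (hi.committed k T' hk).mono hx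
  · intro k h1 h2
    rw [hloc] at h2
    rcases Nat.lt_or_ge (σ.loc q).kmax k with hlt | hle
    · obtain rfl : k = (σ.loc q).kmax + 1 := le_antisymm h2 hlt
      refine ⟨some T, hc.mono hx, ?_⟩
      rintro T' ⟨⟩
      exact ⟨_, le_rfl, (hh _ _).2 (Or.inl ⟨rfl, rfl⟩)⟩
    · obtain ⟨d, hd, hdT⟩ := hi.covered k h1 hle
      refine ⟨d, hd.mono hx, fun T' hT' => ?_⟩
      obtain ⟨j, hj, hjT⟩ := hdT T' hT'
      exact ⟨j, hj, (hh _ _).2 (Or.inr hjT)⟩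
  · intro k k' T' hk hk'
    rcases (hh k T').1 hk with ⟨rfl, rfl⟩ | hk <;> rcases (hh k' T').1 hk' with ⟨rfl, h⟩ | hk'
    · rfl
    · exact absurd hk' (hno _)
    · exact absurd (h ▸ hk) (hno _)
    · exact hi.unique k k' T' hk hk'
  · intro k k' T' hk
    rw [hloc] at hk ⊢
    rcases hk with hk | hk
    · cases hk
      exact (hnew k').2
    · exact hi.disjoint k k' T' hk
  · rw [hloc]
    exact hi.nodup
  · intro k k' T₁ T₂ h1 h2 hcon
    rw [hloc] at h1 h2
    rcases h1 with h1 | h1 <;> rcases h2 with h2 | h2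
    · cases h1
      cases h2
      rfl
    · cases h1
      exact absurd hcon (hfree _ _ h2)
    · cases h2
      exact absurd hcon.symm (hfree _ _ h1)
    · exact hi.locks_conflict k k' T₁ T₂ h1 h2 hcon
  · intro k k' T₁ T₂ h1 h2 hcon
    rw [hloc] at h1 h2
    rcases h2 with h2 | h2
    · cases h2
      exact Nat.lt_succ_of_le (hi.bounds k T₁ (Or.inr h1)).2
    · exact hi.lock_order k k' T₁ T₂ h1 h2 hcon
  · rw [hloc]
    exact hi.log_order
  · rintro T' w k B (hm | ⟨-, -, hm⟩)
    · obtain ⟨j, hj⟩ := hi.forward_handled T' w k B hm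
      exact ⟨j, (hh _ _).2 (Or.inr hj)⟩
    · cases hm
      exact ⟨_, (hh _ _).2 (Or.inl ⟨rfl, rfl⟩)⟩
  · rintro T' (hm | ⟨-, -, hm⟩)
    · simpa only [Executed, hloc] using hi.execute_executed T' hm
    · cases hm

/-- A skipped transaction was handled at an earlier number; this is why `covered` asks for some `j ≤
k` instead of `j = k`. -/
theorem ReplicaInv.skip {σ : State Shard Tx R.n} {q : Shard × Fin R.n} (hi : ReplicaInv σ q)
    {d : Req Tx} (hc : Committed σ q.1 ((σ.loc q).kmax + 1) d)
    (hold : ∀ T, d = some T → ∃ j, (j, T) ∈ (σ.loc q).locks ∨ (j, T) ∈ (σ.loc q).log) :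
    ReplicaInv (act σ q { σ.loc q with kmax := (σ.loc q).kmax + 1 } ∅) q := by
  set τ := act σ q { σ.loc q with kmax := (σ.loc q).kmax + 1 } ∅ with hτ
  have hx : Extends σ τ := extends_act ..
  have hloc : τ.loc q = { σ.loc q with kmax := (σ.loc q).kmax + 1 } := act_loc_self ..
  have hh : ∀ k T', Handled τ q k T' ↔ Handled σ q k T' := by simp [Handled, hloc]
  have hsent : ∀ p, p ∈ τ.sent → p ∈ σ.sent := by simp [hτ]
  refine ⟨?_, ?_, ?_, ?_, ?_, ?_, ?_, ?_, ?_, ?_, ?_⟩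
  · intro k T hk
    have := hi.bounds k T ((hh k T).1 hk)
    rw [hloc]
    exact ⟨this.1, by simp only; omega⟩
  · exact fun k T hk => (hi.committed k T ((hh k T).1 hk)).mono hx
  · intro k h1 h2
    rw [hloc] at h2
    simp only [hh]
    rcases Nat.lt_or_ge (σ.loc q).kmax k with hlt | hle
    · obtain rfl : k = (σ.loc q).kmax + 1 := le_antisymm h2 hlt
      refine ⟨d, hc.mono hx, fun T hT => ?_⟩
      obtain ⟨j, hj⟩ := hold T hT
      exact ⟨j, (hi.bounds j T hj).2.trans (Nat.le_succ _), hj⟩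
    · obtain ⟨d, hd, hdT⟩ := hi.covered k h1 hle
      exact ⟨d, hd.mono hx, hdT⟩
  · simpa only [hh] using hi.unique
  · simpa only [hloc] using hi.disjoint
  · simpa only [hloc] using hi.nodup
  · simpa only [hloc] using hi.locks_conflict
  · simpa only [hloc] using hi.lock_order
  · simpa only [hloc] using hi.log_order
  · intro T v k A hm
    simpa only [hh] using hi.forward_handled T v k A (hsent _ hm)
  · intro T hm
    simpa only [Executed, hloc] using hi.execute_executed T (hsent _ hm)

theorem handled_act_execute {σ : State Shard Tx R.n} {q : Shard × Fin R.n} {k₀ : ℕ} {T₀ : Tx}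
    (hl : (k₀, T₀) ∈ (σ.loc q).locks) (ms : Set (Msg Tx R.n)) (k : ℕ) (T : Tx) :
    Handled (act σ q { σ.loc q with
          locks := (σ.loc q).locks \ {(k₀, T₀)}
          log := (σ.loc q).log ++ [(k₀, T₀)] } ms) q k T ↔ Handled σ q k T := by
  by_cases h : (k, T) = (k₀, T₀)
  · cases h
    simp [Handled, hl]
  · simp [Handled, h]

/-- The entry moves to the end of the log. Conflicting entries already there have smaller numbers by
`lock_order`, and no remaining lock conflicts with it, so both orders persist. -/
theorem ReplicaInv.execute {σ : State Shard Tx R.n} {q : Shard × Fin R.n} (hi : ReplicaInv σ q)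
    {k₀ : ℕ} {T₀ : Tx} (hl : (k₀, T₀) ∈ (σ.loc q).locks) :
    ReplicaInv (act σ q { σ.loc q with
          locks := (σ.loc q).locks \ {(k₀, T₀)}
          log := (σ.loc q).log ++ [(k₀, T₀)] }
        {m | R.IsCross T₀ ∧ m = .execute T₀}) q := by
  have hh := handled_act_execute hl {m | R.IsCross T₀ ∧ m = .execute T₀}
  set τ := act σ q { σ.loc q with
          locks := (σ.loc q).locks \ {(k₀, T₀)}
          log := (σ.loc q).log ++ [(k₀, T₀)] }
        {m | R.IsCross T₀ ∧ m = .execute T₀} with hτ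
  have hx : Extends σ τ := extends_act ..
  have hloc : τ.loc q = { σ.loc q with
          locks := (σ.loc q).locks \ {(k₀, T₀)}
          log := (σ.loc q).log ++ [(k₀, T₀)] } := act_loc_self ..
  refine ⟨?_, ?_, ?_, ?_, ?_, ?_, ?_, ?_, ?_, ?_, ?_⟩
  · intro k T hk
    rw [hloc]
    exact hi.bounds k T ((hh k T).1 hk)
  · exact fun k T hk => (hi.committed k T ((hh k T).1 hk)).mono hx
  · intro k h1 h2
    rw [hloc] at h2
    obtain ⟨d, hd, hdT⟩ := hi.covered k h1 h2
    simp only [hh]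
    exact ⟨d, hd.mono hx, hdT⟩
  · simpa only [hh] using hi.unique
  · intro k k' T hk hk'
    rw [hloc] at hk hk'
    rcases List.mem_append.1 hk' with hk' | hk'
    · exact hi.disjoint k k' T hk.1 hk'
    · obtain ⟨rfl, rfl⟩ : k' = k₀ ∧ T = T₀ := by simpa using hk'
      obtain rfl := hi.unique k k' T (Or.inl hk.1) (Or.inl hl)
      exact hk.2 rfl
  · rw [hloc]
    simp only [List.map_append, List.map_cons, List.map_nil]
    refine List.nodup_append.2 ⟨hi.nodup, by simp, ?_⟩
    intro T hT T' hT' hTT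
    obtain rfl : T' = T₀ := by simpa using hT'
    subst hTT
    obtain ⟨⟨k, T⟩, hk, rfl⟩ := List.mem_map.1 hT
    exact hi.disjoint _ _ _ hl hk
  · intro k k' T T' h1 h2
    rw [hloc] at h1 h2
    exact hi.locks_conflict k k' T T' h1.1 h2.1
  · intro k k' T T' h1 h2 hcon
    rw [hloc] at h1 h2
    rcases List.mem_append.1 h1 with h1 | h1
    · exact hi.lock_order k k' T T' h1 h2.1 hcon
    · obtain ⟨rfl, rfl⟩ : k = k₀ ∧ T = T₀ := by simpa using h1
      obtain rfl := hi.locks_conflict _ _ _ _ hl h2.1 hcon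
      obtain rfl := hi.unique k k' T (Or.inl hl) (Or.inl h2.1)
      exact absurd rfl h2.2
  · rw [hloc]
    refine List.pairwise_append.2 ⟨hi.log_order, by simp, ?_⟩
    rintro ⟨k, T⟩ hk b hb hcon
    obtain rfl : b = (k₀, T₀) := by simpa using hb
    exact hi.lock_order k k₀ T T₀ hk hl hcon
  · rintro T v k A (hm | ⟨-, -, hm⟩)
    · simpa only [hh] using hi.forward_handled T v k A hm
    · cases hm
  · rintro T (hm | ⟨-, -, hm⟩)
    · obtain ⟨j, hj⟩ := hi.execute_executed T hm
      refine ⟨j, ?_⟩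
      rw [Executed, hloc]
      exact List.mem_append_left _ hj
    · cases hm
      refine ⟨k₀, ?_⟩
      rw [Executed, hloc]
      simp

theorem ReplicaInv.of_ne {σ : State Shard Tx R.n} {q r : Shard × Fin R.n} (hne : q ≠ r)
    (hi : ReplicaInv σ q) (l : Loc Tx) (ms : Set (Msg Tx R.n)) :
    ReplicaInv (act σ r l ms) q := by
  refine hi.of_unchanged (extends_act ..) ?_ ?_ ?_ ?_ ?_ <;> simp [act_loc_of_ne _ _ _ _ hne, hne]

theorem ReplicaInv.step {σ τ : State Shard Tx R.n} (hin : ∀ r, σ.inbox r ⊆ σ.sent)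
    {q : Shard × Fin R.n} (hq : q ∉ R.byz) (hi : ReplicaInv σ q) (hs : Step σ τ) :
    ReplicaInv τ q := by
  have he := hs.extends
  cases hs
  case clientRequest => exact hi.of_unchanged he rfl rfl rfl (by simp) (by simp)
  case deliver => exact hi.of_unchanged he rfl rfl rfl (by simp) (by simp)
  case byzantine r m hr =>
    have hne : q ≠ r := fun h => hq (h ▸ hr)
    exact hi.of_unchanged he rfl rfl rfl (by simp [hne]) (by simp [hne])
  case lock r v T A _ hA hcom hnew hfree =>
    by_cases hr : q = r
    · subst hr
      exact hi.lock ⟨v, A, hA, fun i hiA => hin q (hcom i hiA)⟩ hnew hfree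
    · exact hi.of_ne hr _ _
  case skip r v d _ hf hold =>
    by_cases hr : q = r
    · subst hr
      exact hi.skip ⟨v, hf.quorumSent hin⟩ hold
    · exact hi.of_ne hr _ _
  case execute r k T _ hl _ =>
    by_cases hr : q = r
    · subst hr
      exact hi.execute hl
    · exact hi.of_ne hr _ _
  all_goals
    rename Shard × Fin R.n => r
    by_cases hr : q = r
    · subst hr
      refine hi.of_unchanged he ?_ ?_ ?_ ?_ ?_ <;> simp
    · exact hi.of_ne hr _ _

theorem Reachable.replicaInv {σ : State Shard Tx R.n} (h : Reachable σ) {q : Shard × Fin R.n}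
    (hq : q ∉ R.byz) : ReplicaInv σ q := by
  induction h with
  | refl =>
    constructor <;> simp [System.start, Handled]
    omega
  | tail hr hs ih => exact ih.step (Reachable.inbox_subset hr) hq hs

/-! ### Effect of a step on handled and executed transactions -/

theorem Step.handled_mono {σ τ : State Shard Tx R.n} (h : Step σ τ) {q : Shard × Fin R.n} {k : ℕ}
    {T : Tx} (hq : Handled σ q k T) : Handled τ q k T := by
  cases h
  case clientRequest => exact hq
  case deliver => exact hq
  case byzantine => exact hq
  case execute r k₀ T₀ _ hl _ =>
    by_cases hr : q = r
    · subst hr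
      exact (handled_act_execute hl _ k T).2 hq
    · simpa [Handled, act_loc_of_ne _ _ _ _ hr] using hq
  all_goals
    rename Shard × Fin R.n => r
    by_cases hr : q = r
    · subst hr
      simp only [Handled, act_loc_self]
      first
        | exact hq
        | exact hq.imp_left (Set.mem_insert_of_mem _)
    · simpa [Handled, act_loc_of_ne _ _ _ _ hr] using hq

/-- A step executes only locked transactions for which the conditions are met. -/
theorem Step.executed_cases {σ τ : State Shard Tx R.n} (h : Step σ τ) {q : Shard × Fin R.n} {k : ℕ}
    {T : Tx} (hq : Executed τ q k T) :
    Executed σ q k T ∨ (Handled σ q k T ∧ CanExecute σ q T) := by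
  cases h
  case clientRequest => exact Or.inl hq
  case deliver => exact Or.inl hq
  case byzantine => exact Or.inl hq
  case execute r k₀ T₀ _ hl hc =>
    by_cases hr : q = r
    · subst hr
      rw [Executed, act_loc_self] at hq
      rcases List.mem_append.1 hq with hq | hq
      · exact Or.inl hq
      · obtain ⟨rfl, rfl⟩ : k = k₀ ∧ T = T₀ := by simpa using hq
        exact Or.inr ⟨Or.inl hl, hc⟩
    · exact Or.inl (by simpa [Executed, act_loc_of_ne _ _ _ _ hr] using hq)
  all_goals
    rename Shard × Fin R.n => r
    left
    by_cases hr : q = r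
    · subst hr
      simpa [Executed] using hq
    · simpa [Executed, act_loc_of_ne _ _ _ _ hr] using hq

/-- A step that orders a transaction orders only one, and executes none. -/
theorem Step.handled_cases {σ τ : State Shard Tx R.n} (h : Step σ τ) :
    (∀ q k T, Handled τ q k T → Handled σ q k T) ∨
      ∃ T₀, (∀ q k T, Handled τ q k T → Handled σ q k T ∨ T = T₀) ∧
        ∀ q k T, Executed τ q k T → Executed σ q k T := by
  cases h
  case clientRequest => exact Or.inl fun _ _ _ h => h
  case deliver => exact Or.inl fun _ _ _ h => h
  case byzantine => exact Or.inl fun _ _ _ h => h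
  case execute r k₀ T₀ _ hl _ =>
    left
    intro q k T hq
    by_cases hr : q = r
    · subst hr
      exact (handled_act_execute hl _ k T).1 hq
    · simpa [Handled, act_loc_of_ne _ _ _ _ hr] using hq
  case lock r v T₀ A _ _ _ _ _ =>
    refine Or.inr ⟨T₀, fun q k T hq => ?_, fun q k T hq => ?_⟩
    · by_cases hr : q = r
      · subst hr
        rw [Handled, act_loc_self] at hq
        rcases hq with (hq | hq) | hq
        · cases hq
          exact Or.inr rfl
        · exact Or.inl (Or.inl hq)
        · exact Or.inl (Or.inr hq)
      · exact Or.inl (by simpa [Handled, act_loc_of_ne _ _ _ _ hr] using hq)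
    · by_cases hr : q = r
      · subst hr
        simpa [Executed] using hq
      · simpa [Executed, act_loc_of_ne _ _ _ _ hr] using hq
  all_goals
    rename Shard × Fin R.n => r
    left
    intro q k T hq
    by_cases hr : q = r
    · subst hr
      simpa [Handled] using hq
    · simpa [Handled, act_loc_of_ne _ _ _ _ hr] using hq

theorem extends_of_reflTransGen {σ τ : State Shard Tx R.n} (h : Relation.ReflTransGen Step σ τ) :
    Extends σ τ := by
  induction h with
  | refl => exact ⟨subset_rfl, subset_rfl, fun _ => subset_rfl⟩
  | tail _ hs ih =>
    have he := hs.extends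
    exact ⟨ih.requests.trans he.requests, ih.sent.trans he.sent,
      fun r => (ih.inbox r).trans (he.inbox r)⟩

theorem handled_of_reflTransGen {σ τ : State Shard Tx R.n} (h : Relation.ReflTransGen Step σ τ)
    {q : Shard × Fin R.n} {k : ℕ} {T : Tx} (hq : Handled σ q k T) : Handled τ q k T := by
  induction h with
  | refl => exact hq
  | tail _ hs ih => exact hs.handled_mono ih

/-- Some non-faulty replica of `s` has ordered `T` and acquired its locks. -/
def Processed (σ : State Shard Tx R.n) (s : Shard) (T : Tx) : Prop :=
  ∃ i j, (s, i) ∉ R.byz ∧ Handled σ (s, i) j T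

/-- All involved shards have processed `T`. -/
def Complete (σ : State Shard Tx R.n) (T : Tx) : Prop :=
  ∀ s ∈ R.involved T, Processed σ s T

theorem Complete.step {σ τ : State Shard Tx R.n} (h : Step σ τ) {T : Tx} (hc : Complete σ T) :
    Complete τ T := by
  intro s hs
  obtain ⟨i, j, hi, hj⟩ := hc s hs
  exact ⟨i, j, hi, h.handled_mono hj⟩

theorem System.ConflictAt.involved {s : Shard} {T T' : Tx} (h : R.ConflictAt s T T') :
    s ∈ R.involved T := by
  obtain ⟨x, rfl, hx | hx, -⟩ := h
  · exact Finset.mem_union_left _ (Finset.mem_image_of_mem _ hx)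
  · exact Finset.mem_union_right _ (Finset.mem_image_of_mem _ hx)

theorem Eligible.involved {σ : State Shard Tx R.n} {q : Shard × Fin R.n} {T : Tx}
    (h : Eligible σ q T) : q.1 ∈ R.involved T :=
  h.2.elim (fun h => h.1) fun h => h.1

/-! ### First rotation, completeness, and numbers across replicas -/

section Safety

variable (hn : 3 * R.f + 1 ≤ R.n)
  (hbyz : ∀ s : Shard, {i : Fin R.n | (s, i) ∈ R.byz}.ncard ≤ R.f)
  {σ τ : State Shard Tx R.n} (hσ : Reachable σ)

-- One of the `f + 1` senders is non-faulty, and such a replica forwards only transactions that it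
-- has locked.
include hbyz hσ in
theorem HasFrom.processed {r : Shard × Fin R.n} {u : Shard} {T : Tx}
    (h : HasFrom σ r u (R.f + 1) (ValidForward σ u T)) : Processed σ u T := by
  obtain ⟨A, hA, hf⟩ := h
  obtain ⟨i, hiA, hi⟩ := exists_honest_of_lt_card hbyz u A hA
  obtain ⟨_, ⟨v, k, B, rfl, -⟩, hm⟩ := hf i hiA
  obtain ⟨j, hj⟩ := (hσ.replicaInv hi).forward_handled _ _ _ _ (hσ.inbox_subset _ hm)
  exact ⟨i, j, hi, hj⟩

include hn hbyz hσ

theorem Handled.exists_eligible {q : Shard × Fin R.n} {k : ℕ} {T : Tx} (hq : q ∉ R.byz)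
    (h : Handled σ q k T) : ∃ i, (q.1, i) ∉ R.byz ∧ Eligible σ (q.1, i) T :=
  ((hσ.replicaInv hq).committed k T h).exists_eligible hn hbyz hσ

theorem Handled.involved {q : Shard × Fin R.n} {k : ℕ} {T : Tx} (hq : q ∉ R.byz)
    (h : Handled σ q k T) : q.1 ∈ R.involved T := by
  obtain ⟨i, -, hi⟩ := h.exists_eligible hn hbyz hσ hq
  exact hi.involved

/-- The first rotation: a shard processes `T` only after all involved shards before it. -/
theorem Processed.of_le {s u : Shard} {T : Tx} (h : Processed σ s T) (hs : s ∈ R.involved T)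
    (hu : u ∈ R.involved T) (hus : u ≤ s) : Processed σ u T := by
  classical
  -- If the least processing shard at or after `u` were not `u` itself, it would not be the first
  -- involved one. Its eligible replica would then hold forwards from its predecessor, which lies in
  -- `F` too and is smaller.
  set F := (R.involved T).filter fun w => u ≤ w ∧ Processed σ w T with hF
  have hne : F.Nonempty := ⟨s, by simp [hF, hs, hus, h]⟩
  obtain ⟨hm, hum, hp⟩ : F.min' hne ∈ R.involved T ∧ u ≤ F.min' hne ∧ Processed σ (F.min' hne) T :=
    by simpa [hF] using F.min'_mem hne
  rcases hum.eq_or_lt with heq | hlt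
  · exact heq ▸ hp
  · exfalso
    obtain ⟨i, j, hi, hj⟩ := hp
    obtain ⟨i', -, -, hel | ⟨-, w, hw, hfw⟩⟩ := hj.exists_eligible hn hbyz hσ hi
    · exact absurd (hel.2 u hu) (not_le.2 hlt)
    · rcases hw with ⟨hwi, -, hwm, hbetween⟩ | ⟨-, hfirst⟩
      · have huw : u ≤ w := not_lt.1 fun hwu => hbetween u hu ⟨hwu, hlt⟩
        have hwF : w ∈ F := by
          simp only [hF, Finset.mem_filter]
          exact ⟨hwi, huw, hfw.processed hbyz hσ⟩
        exact absurd (F.min'_le w hwF) (not_le.2 hwm)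
      · exact absurd (hfirst.2 u hu) (not_le.2 hlt)

theorem Processed.complete_of_isLast {s : Shard} {T : Tx} (h : Processed σ s T)
    (hs : R.IsLast T s) : Complete σ T :=
  fun u hu => h.of_le hn hbyz hσ hs.1 hu (hs.2 u hu)

/-- Only transactions that all involved shards have processed are executed. -/
theorem Executed.complete {q : Shard × Fin R.n} {k : ℕ} {T : Tx} (hq : q ∉ R.byz)
    (h : Executed σ q k T) : Complete σ T := by
  induction hσ generalizing q k T with
  | refl => simp [Executed, System.start] at h
  | @tail σ τ hr hs ih =>
    replace hr : Reachable σ := hr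
    refine Complete.step hs ?_
    rcases hs.executed_cases h with h | ⟨hh, hl | ⟨-, u, hu, hf⟩ | ⟨u, -, hf⟩⟩
    · exact ih hq h
    · exact Processed.complete_of_isLast hn hbyz hr ⟨q.2, k, hq, hh⟩ hl
    · exact (hf.processed hbyz hr).complete_of_isLast hn hbyz hr hu
    -- A non-faulty sender of Execute had executed `T` before this step, so the induction hypothesis
    -- applies to that sender.
    · obtain ⟨A, hA, hf⟩ := hf
      obtain ⟨i, hiA, hi⟩ := exists_honest_of_lt_card hbyz u A hA
      obtain ⟨_, rfl, hm⟩ := hf i hiA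
      obtain ⟨j, hj⟩ := (hr.replicaInv hi).execute_executed _ (hr.inbox_subset _ hm)
      exact ih hi hj

/-- A transaction has the same sequence number at all non-faulty replicas of a shard. -/
theorem Handled.number_unique {s : Shard} {i j : Fin R.n} {k k' : ℕ} {T : Tx}
    (hi : (s, i) ∉ R.byz) (hj : (s, j) ∉ R.byz) (h : Handled σ (s, i) k T)
    (h' : Handled σ (s, j) k' T) : k = k' := by
  wlog hlt : k < k' generalizing i j k k'
  · by_contra hne
    exact hne (this hj hi h' h (by omega)).symm
  have hI := hσ.replicaInv hi
  have hJ := hσ.replicaInv hj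
  -- Replica `j` has passed number `k`, where by agreement `T` is committed; so it handled `T` at
  -- some number at most `k`, contrary to its only number being `k'`.
  obtain ⟨d, hd, hdT⟩ := hJ.covered k (hI.bounds k T h).1 (hlt.le.trans (hJ.bounds k' T h').2)
  obtain ⟨l, hl, hlT⟩ := hdT T (hd.unique hn hbyz hσ (hI.committed k T h))
  have := hJ.unique l k' T hlT h'
  omega

/-- A non-faulty replica that handled `T'` handled all transactions with smaller numbers before. -/
theorem Handled.of_lt (hστ : Relation.ReflTransGen Step σ τ) {s : Shard} {i j : Fin R.n}
    {k k' : ℕ} {T T' : Tx} (hi : (s, i) ∉ R.byz) (hj : (s, j) ∉ R.byz)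
    (h : Handled τ (s, i) k T) (h' : Handled σ (s, j) k' T') (hlt : k < k') :
    Handled σ (s, j) k T := by
  have hτ : Reachable τ := hσ.trans hστ
  have hI := hτ.replicaInv hi
  have hJ := hσ.replicaInv hj
  -- In `σ` replica `j` has already passed `k`. That the request there is `T` may become known only
  -- in `τ`, so agreement is applied in `τ`.
  obtain ⟨d, hd, hdT⟩ := hJ.covered k (hI.bounds k T h).1 (hlt.le.trans (hJ.bounds k' T' h').2)
  obtain ⟨l, hl, hlT⟩ := hdT T
    ((hd.mono (extends_of_reflTransGen hστ)).unique hn hbyz hτ (hI.committed k T h))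
  have := Handled.number_unique hn hbyz hτ hi hj h (handled_of_reflTransGen hστ hlT)
  exact this ▸ hlT

end Safety

/-! ### Execution order of conflicting transactions at one replica -/

/-- If `T` were still locked, `T'` could not be locked, since held locks do not conflict, nor
executed, since executed conflicting transactions have smaller numbers than locked ones. -/
theorem ReplicaInv.executed_of_lt {σ : State Shard Tx R.n} {q : Shard × Fin R.n}
    (hi : ReplicaInv σ q) {k k' : ℕ} {T T' : Tx} (hc : R.ConflictAt q.1 T T')
    (h : Handled σ q k T) (h' : Handled σ q k' T') (hlt : k < k') : Executed σ q k T := by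
  rcases h with h | h
  · exfalso
    rcases h' with h' | h'
    · obtain rfl := hi.locks_conflict _ _ _ _ h h' hc
      have := hi.unique _ _ _ (Or.inl h) (Or.inl h')
      omega
    · have := hi.lock_order _ _ _ _ h' h hc.symm
      omega
  · exact h

theorem pair_sublist_or_of_mem {α : Type*} {a b : α} {l : List α} (ha : a ∈ l) (hb : b ∈ l)
    (hab : a ≠ b) : [a, b].Sublist l ∨ [b, a].Sublist l := by
  induction l with
  | nil => simp at ha
  | cons c l ih =>
    rcases List.mem_cons.1 ha with hac | ha'
    · subst hac
      have hb' := (List.mem_cons.1 hb).resolve_left hab.symm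
      exact Or.inl ((List.singleton_sublist.2 hb').cons_cons _)
    · rcases List.mem_cons.1 hb with hbc | hb'
      · subst hbc
        exact Or.inr ((List.singleton_sublist.2 ha').cons_cons _)
      · exact (ih ha' hb').imp (fun h => h.cons _) fun h => h.cons _

theorem ReplicaInv.executedBefore_of_lt {σ : State Shard Tx R.n} {q : Shard × Fin R.n}
    (hi : ReplicaInv σ q) {k k' : ℕ} {T T' : Tx} (hc : R.ConflictAt q.1 T T')
    (h : Executed σ q k T) (h' : Executed σ q k' T') (hlt : k < k') :
    ExecutedBefore σ q T T' := by
  have hne : (k, T) ≠ (k', T') := fun h => hlt.ne (congrArg Prod.fst h)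
  rcases pair_sublist_or_of_mem h h' hne with hs | hs
  · exact hs.map Prod.snd
  · have := List.pairwise_pair.1 (hi.log_order.sublist hs) hc.symm
    simp only at this
    omega

theorem ReplicaInv.lt_of_executedBefore {σ : State Shard Tx R.n} {q : Shard × Fin R.n}
    (hi : ReplicaInv σ q) {T T' : Tx} (hc : R.ConflictAt q.1 T T')
    (h : ExecutedBefore σ q T T') :
    ∃ k k', Executed σ q k T ∧ Executed σ q k' T' ∧ k < k' := by
  obtain ⟨l, hl, hlT⟩ := List.sublist_map_iff.1 h
  match l, hlT with
  | [a, b], hlT =>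
    obtain ⟨rfl, rfl⟩ : T = a.2 ∧ T' = b.2 := by simpa using hlT
    exact ⟨a.1, b.1, hl.subset (by simp), hl.subset (by simp),
      List.pairwise_pair.1 (hi.log_order.sublist hl) hc⟩

/-! ### Global rank and the safety properties -/

section Safety

variable (hn : 3 * R.f + 1 ≤ R.n)
  (hbyz : ∀ s : Shard, {i : Fin R.n | (s, i) ∈ R.byz}.ncard ≤ R.f)
  {σ : State Shard Tx R.n} (hσ : Reachable σ)

/-- `rank` orders the transactions by the times at which all involved shards had processed them;
`N` bounds the ranks given so far. -/
structure IsRank (σ : State Shard Tx R.n) (rank : Tx → ℕ) (N : ℕ) : Prop where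
  lt_bound : ∀ T, Complete σ T → rank T < N
  lt_of_lt : ∀ s i j k k' T T', (s, i) ∉ R.byz → (s, j) ∉ R.byz → R.ConflictAt s T T' →
    Handled σ (s, i) k T → Handled σ (s, j) k' T' → k < k' → Complete σ T' → rank T < rank T'

include hn hbyz hσ

/-- Induction on the run: each step completes at most one transaction, which receives the next
unused rank. The lock discipline ensures that its conflicting predecessors were complete before. -/
theorem exists_isRank : ∃ rank N, IsRank σ rank N := by
  classical
  induction hσ with
  | refl =>
    refine ⟨fun _ => 0, 1, fun _ _ => Nat.zero_lt_one, ?_⟩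
    intro s i j k k' T T' _ _ _ h
    simp [Handled, System.start] at h
  | @tail σ τ hr hs ih =>
    replace hr : Reachable σ := hr
    have hτ : Reachable τ := hr.tail hs
    obtain ⟨rank, N, hrank⟩ := ih
    -- If `T'` was complete before the step, a non-faulty replica `l` of `s` had handled it, hence
    -- had executed `T`. Thus `T` was complete too, even if `i` orders it only in this step.
    have hold : ∀ s i j k k' T T', (s, i) ∉ R.byz → (s, j) ∉ R.byz → R.ConflictAt s T T' →
        Handled τ (s, i) k T → Handled τ (s, j) k' T' → k < k' → Complete σ T' →
        rank T < rank T' ∧ Complete σ T := by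
      intro s i j k k' T T' hi hj hc h h' hlt hT'
      obtain ⟨l, k'', hl, hk''⟩ := hT' s hc.symm.involved
      obtain rfl := Handled.number_unique hn hbyz hτ hj hl h' (hs.handled_mono hk'')
      have hk := Handled.of_lt hn hbyz hr (.single hs) hi hl h hk'' hlt
      have hex := (hr.replicaInv hl).executed_of_lt hc hk hk'' hlt
      exact ⟨hrank.lt_of_lt s l l k k' T T' hl hl hc hk hk'' hlt hT', hex.complete hn hbyz hr hl⟩
    by_cases hnew : ∃ T₀, Complete τ T₀ ∧ ¬ Complete σ T₀
    · obtain ⟨T₀, hT₀, hT₀'⟩ := hnew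
      obtain ⟨s₀, hs₀, hproc⟩ : ∃ s ∈ R.involved T₀, ¬ Processed σ s T₀ := by
        simpa [Complete] using hT₀'
      obtain ⟨i₀, k₀, hi₀, hk₀⟩ := hT₀ s₀ hs₀
      rcases hs.handled_cases with hsame | ⟨T₁, hone, hlog⟩
      · exact absurd ⟨i₀, k₀, hi₀, hsame _ _ _ hk₀⟩ hproc
      obtain rfl : T₀ = T₁ :=
        (hone _ _ _ hk₀).resolve_left fun h => hproc ⟨i₀, k₀, hi₀, h⟩
      have hcomp : ∀ T, T ≠ T₀ → Complete τ T → Complete σ T := by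
        intro T hT hc s hs
        obtain ⟨i, k, hi, hk⟩ := hc s hs
        exact ⟨i, k, hi, (hone _ _ _ hk).resolve_right hT⟩
      refine ⟨Function.update rank T₀ N, N + 1, ?_, ?_⟩
      · intro T hT
        by_cases h : T = T₀
        · subst h
          simp
        · rw [Function.update_of_ne h]
          exact (hrank.lt_bound T (hcomp T h hT)).trans (Nat.lt_succ_self N)
      · intro s i j k k' T T' hi hj hc h h' hlt hT'
        by_cases hT : T' = T₀
        · subst hT
          have hk := Handled.of_lt hn hbyz hτ .refl hi hj h h' hlt
          -- In the new state `j` has executed `T`; the completing step is one that executes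
          -- nothing, so this execution, and with it the completeness of `T`, predates the step.
          have hex := hlog _ _ _ ((hτ.replicaInv hj).executed_of_lt hc hk h' hlt)
          have hTc := hex.complete hn hbyz hr hj
          have hne : T ≠ T' := fun h => hT₀' (h ▸ hTc)
          rw [Function.update_of_ne hne, Function.update_self]
          exact hrank.lt_bound T hTc
        · obtain ⟨h1, h2⟩ := hold s i j k k' T T' hi hj hc h h' hlt (hcomp T' hT hT')
          have hne : T ≠ T₀ := fun h => hT₀' (h ▸ h2)
          rwa [Function.update_of_ne hne, Function.update_of_ne hT]
    · push Not at hnew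
      exact ⟨rank, N, fun T hT => hrank.lt_bound T (hnew T hT),
        fun s i j k k' T T' hi hj hc h h' hlt hT' =>
          (hold s i j k k' T T' hi hj hc h h' hlt (hnew T' hT')).1⟩

theorem involvement : Involvement σ :=
  ⟨fun _ _ _ hr h => h.complete hn hbyz hσ hr, fun _ _ _ hr h => h.involved hn hbyz hσ hr⟩

theorem nonDivergence : NonDivergence σ := by
  intro s i j k T T' hi hj h h'
  exact Option.some_injective _ (((hσ.replicaInv hi).committed k T (Or.inr h)).unique hn hbyz hσ
    ((hσ.replicaInv hj).committed k T' (Or.inr h')))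

theorem consistence : Consistence σ := by
  obtain ⟨rank, N, hrank⟩ := exists_isRank hn hbyz hσ
  -- An arbitrary well-order breaks ties in rank, making the lexicographic order total on all
  -- transactions, including incomplete ones.
  let _ : LinearOrder Tx := IsWellOrder.linearOrder WellOrderingRel
  let e : Tx ↪ ℕ ×ₗ Tx := ⟨fun T => toLex (rank T, T), fun T T' h =>
    congrArg (fun p => (ofLex p).2) h⟩
  refine ⟨fun T T' => e T < e T', (RelEmbedding.preimage e (· < ·)).isStrictTotalOrder, ?_⟩
  intro r T T' hr hc h
  obtain ⟨k, k', hk, hk', hlt⟩ := (hσ.replicaInv hr).lt_of_executedBefore hc h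
  exact Prod.Lex.toLex_lt_toLex.2 (Or.inl (hrank.lt_of_lt r.1 r.2 r.2 k k' T T' hr hr hc
    (Or.inr hk) (Or.inr hk') hlt (hk'.complete hn hbyz hσ hr)))

theorem sameOrderInShard : SameOrderInShard σ := by
  refine ⟨fun s i j k k' T hi hj h h' =>
    Handled.number_unique hn hbyz hσ hi hj (Or.inr h) (Or.inr h'),
    fun r hr => (hσ.replicaInv hr).nodup, fun r k k' T T' hr hc h h' => ⟨fun hb => ?_,
      (hσ.replicaInv hr).executedBefore_of_lt hc h h'⟩⟩
  have hI := hσ.replicaInv hr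
  obtain ⟨l, l', hl, hl', hlt⟩ := hI.lt_of_executedBefore hc hb
  rwa [hI.unique k l T (Or.inr h) (Or.inr hl), hI.unique k' l' T' (Or.inr h') (Or.inr hl')]

theorem sameOrderAcrossShards : SameOrderAcrossShards σ := by
  rintro r q T T' hr hq hcr hcq hb ⟨m', hm'⟩
  obtain ⟨rank, N, hrank⟩ := exists_isRank hn hbyz hσ
  obtain ⟨k, k', hk, hk', hlt⟩ := (hσ.replicaInv hr).lt_of_executedBefore hcr hb
  have hT := hk.complete hn hbyz hσ hr
  have hrlt := hrank.lt_of_lt r.1 r.2 r.2 k k' T T' hr hr hcr (Or.inr hk) (Or.inr hk') hlt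
    (hk'.complete hn hbyz hσ hr)
  obtain ⟨i, m, hi, hm⟩ := hT q.1 hcq.involved
  have hQ := hσ.replicaInv hq
  -- Here `m` and `m'` are the numbers of `T` and `T'` in the shard of `q`. Equality would identify
  -- the two transactions, and `m' < m` would reverse their ranks; the remaining case makes `q`
  -- execute `T` first.
  rcases lt_trichotomy m m' with hmm | rfl | hmm
  · have hqm := Handled.of_lt hn hbyz hσ .refl hi hq hm (Or.inr hm') hmm
    exact hQ.executedBefore_of_lt hcq (hQ.executed_of_lt hcq hqm (Or.inr hm') hmm) hm' hmm
  · have := ((hσ.replicaInv hi).committed m T hm).unique hn hbyz hσ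
      (hQ.committed m T' (Or.inr hm'))
    cases this
    exact absurd hrlt (lt_irrefl _)
  · have := hrank.lt_of_lt q.1 q.2 i m' m T' T hq hi hcq.symm (Or.inr hm') hm hmm hT
    omega

end Safety

end RingBFT

theorem mainTheorem3 {Shard Item Tx : Type*} [LinearOrder Shard]
    (R : RingBFT.System Shard Item Tx)
    (hn : 3 * R.f + 1 ≤ R.n)
    (hbyz : ∀ s : Shard, {i : Fin R.n | (s, i) ∈ R.byz}.ncard ≤ R.f)
    (σ : RingBFT.State Shard Tx R.n) (hσ : RingBFT.Reachable (R := R) σ) :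
    (RingBFT.Involvement (R := R) σ ∧ RingBFT.NonDivergence (R := R) σ ∧
      RingBFT.Consistence (R := R) σ) ∧
    RingBFT.SameOrderInShard (R := R) σ ∧ RingBFT.SameOrderAcrossShards (R := R) σ :=
  ⟨⟨RingBFT.involvement hn hbyz hσ, RingBFT.nonDivergence hn hbyz hσ,
      RingBFT.consistence hn hbyz hσ⟩,
    RingBFT.sameOrderInShard hn hbyz hσ, RingBFT.sameOrderAcrossShards hn hbyz hσ⟩
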